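/- Let $H$ be a separable infinite-dimensional complex Hilbert space. "Ideal" means a two-sided ideal of $B(H)$ other than $B(H)$ itself. Let $c_o^*$ be the set of real sequences $\langle\xi_n\rangle_{n\ge1}$ decreasing (not necessarily strictly) to $0$, and for an ideal $I$ let $\Sigma(I)=\{s(X): X\in I\}\subset c_o^*$, where $s(X)$ is the sequence of $s$-numbers (singular numbers) of $X$. Put $\omega=\langle 1/n\rangle$ and $\eta_a=\langle \frac1n\sum_{i=1}^n\eta_i\rangle$. For an ideal $I$ let ${}_aI$ and $I_a$ be the ideals with $$\Sigma({}_aI)=\{\xi\in c_o^*: \xi_a\in\Sigma(I)\},\qquad \Sigma(I_a)=\{\xi\in c_o^*: \xi\le C\,\eta_a \text{ pointwise for some } \eta\in\Sigma(I),\ C>0\}.$$ The am-interior of $I$ is $I^o=({}_aI)_a$, and $I$ is called am-open if $I=I^o$. Then the intersection of any nonempty collection of am-open ideals is am-open. Moreover, for every ideal $I$: 1. $\Sigma(I^o)=\{\xi\in c_o^* : \zeta\in\Sigma(I)\}$, where $\zeta_n=\frac1n\max_{1\le i\le n} i\,\xi_i$; that is, $\zeta$ is $\omega$ times the upper nondecreasing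 envelope of $\xi/\omega$. 2. The intersection $I^{oo}$ of all am-open ideals containing $I$ is itself am-open and contains $I$; hence it is the smallest am-open ideal containing $I$. -/

import Mathlib

/-!
Operator ideals on a complex Hilbert space `H` are the two-sided ideals of the ring
`H →L[ℂ] H` of bounded operators.  Sequences are indexed by `ℕ` starting at `0`, so the entry of
index `n` here is the entry of index `n + 1` in the usual notation `⟨ξ₁, ξ₂, …⟩`.
-/

namespace AMIdeal

noncomputable section

/-- `c₀*`: the real sequences decreasing (not necessarily strictly) to `0`.  They are
automatically nonnegative. -/
def cZeroStar : Set (ℕ → ℝ) :=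
  {ξ | Antitone ξ ∧ Filter.Tendsto ξ Filter.atTop (nhds 0)}

/-- The harmonic sequence `ω = ⟨1, 1/2, 1/3, …⟩`. -/
def omega (n : ℕ) : ℝ := 1 / ((n : ℝ) + 1)

/-- The arithmetic (Cesàro) mean `η_a` of a sequence `η`. -/
def arithMean (η : ℕ → ℝ) (n : ℕ) : ℝ :=
  (∑ i ∈ Finset.range (n + 1), η i) / ((n : ℝ) + 1)

/-- The sequence `ω · und (ξ / ω)`, where `und φ = ⟨max_{i ≤ n} φ_i⟩` is the upper monotone
nondecreasing envelope of `φ` (Mathlib's `partialSups φ`). -/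
def omegaUnd (ξ : ℕ → ℝ) (n : ℕ) : ℝ :=
  omega n * partialSups (fun i => ξ i / omega i) n

section Operators

variable {H : Type*} [NormedAddCommGroup H] [InnerProductSpace ℂ H]

/-- The sequence `s(X)` of the `s`-numbers of `X`: its `n`-th entry is the distance in operator
norm from `X` to the operators of rank at most `n`.  For compact `X` these are the eigenvalues of
`|X|` in decreasing order, repeated according to multiplicity. -/
def sNumbers (X : H →L[ℂ] H) (n : ℕ) : ℝ :=
  ⨅ F : {F : H →L[ℂ] H // LinearMap.rank (F : H →ₗ[ℂ] H) ≤ (n : Cardinal)}, ‖X - F.1‖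

/-- The characteristic set `Σ(I)` of an ideal `I`: the sequences in `c₀*` that are the
`s`-numbers of an element of `I`. -/
def charSet (I : TwoSidedIdeal (H →L[ℂ] H)) : Set (ℕ → ℝ) :=
  {ξ | ξ ∈ cZeroStar ∧ ∃ X ∈ I, sNumbers X = ξ}

/-- The inverse of the Calkin correspondence `I ↦ Σ(I)`: the ideal generated by the operators
whose sequence of `s`-numbers lies in `S`.  For `S ⊆ c₀*` all these operators are compact. -/
def idealOf (S : Set (ℕ → ℝ)) : TwoSidedIdeal (H →L[ℂ] H) :=
  TwoSidedIdeal.span {X | sNumbers X ∈ S}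

/-- The pre-arithmetic mean ideal `ₐI`, with characteristic set `{ξ ∈ c₀* | ξ_a ∈ Σ(I)}`. -/
def preArithMeanIdeal (I : TwoSidedIdeal (H →L[ℂ] H)) : TwoSidedIdeal (H →L[ℂ] H) :=
  idealOf {ξ | ξ ∈ cZeroStar ∧ arithMean ξ ∈ charSet I}

/-- The arithmetic mean ideal `I_a`, with characteristic set
`{ξ ∈ c₀* | ξ = O(η_a) for some η ∈ Σ(I)}`.  The bound holds for all indices; for `η ≠ 0` this
agrees with a bound for all large indices, as then `η_a` has no zero entry. -/
def arithMeanIdeal (I : TwoSidedIdeal (H →L[ℂ] H)) : TwoSidedIdeal (H →L[ℂ] H) :=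
  idealOf {ξ | ξ ∈ cZeroStar ∧ ∃ η ∈ charSet I, ∃ C : ℝ, ∀ n, ξ n ≤ C * arithMean η n}

/-- The am-interior `I^o = (ₐI)_a`. -/
def amInterior (I : TwoSidedIdeal (H →L[ℂ] H)) : TwoSidedIdeal (H →L[ℂ] H) :=
  arithMeanIdeal (preArithMeanIdeal I)

/-- An ideal is am-open if it coincides with its am-interior.  The am-interior consists of
compact operators, so the improper ideal `⊤` is not am-open when `H` is infinite dimensional. -/
def IsAmOpen (I : TwoSidedIdeal (H →L[ℂ] H)) : Prop :=
  amInterior I = I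

/-- `I^{oo}`: the intersection of all am-open ideals containing `I`. -/
def amOpenHull (I : TwoSidedIdeal (H →L[ℂ] H)) : TwoSidedIdeal (H →L[ℂ] H) :=
  sInf {J | IsAmOpen J ∧ I ≤ J}

end Operators

end

end AMIdeal

namespace AMIdeal

noncomputable section

open Filter Topology
open scoped InnerProductSpace

/-! By the Calkin correspondence a proper ideal is determined by its characteristic set, and these
sets are exactly the hereditary cones in `c₀*` closed under dilation (`charSet_idealOf`,
`isCharSet_charSet`, `mem_iff_sNumbers_mem_charSet`). This rests on the singular value decomposition
of compact operators and on the fact that a noncompact operator factors the identity.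

The formula for the am-interior is then a statement about sequences, `meanSet_preMeanSet`. Partial
sums of `η ≥ 0` are nondecreasing, so a bound `ξ ≤ C η_a` passes to `omegaUnd ξ`. Conversely `und (ξ
/ ω)` is quasi-concave, hence equivalent up to a factor 2 to a concave sequence, whose increments
form some `η` in `c₀*`.

Consequently a proper ideal is am-open iff `ξ` and `omegaUnd ξ` belong to its characteristic set
simultaneously. This condition on single sequences survives intersections. The compact operators
form an am-open ideal containing every proper ideal, so the hull is a nonempty intersection. -/

/-! ### The cone `c₀*` and characteristic sets. -/

theorem cZeroStar.nonneg {ξ : ℕ → ℝ} (h : ξ ∈ cZeroStar) (n : ℕ) : 0 ≤ ξ n :=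
  h.1.le_of_tendsto h.2 n

theorem mem_cZeroStar_of_le {ξ η : ℕ → ℝ} (hξ : Antitone ξ) (h0 : ∀ n, 0 ≤ ξ n)
    (hη : Tendsto η atTop (𝓝 0)) (h : ∀ n, ξ n ≤ η n) : ξ ∈ cZeroStar :=
  ⟨hξ, squeeze_zero h0 h hη⟩

/-- The dilation `⟨ξ₁, ξ₁, ξ₂, ξ₂, …⟩` of a sequence. -/
def dilate (ξ : ℕ → ℝ) (n : ℕ) : ℝ := ξ (n / 2)

theorem dilate_mem_cZeroStar {ξ : ℕ → ℝ} (h : ξ ∈ cZeroStar) : dilate ξ ∈ cZeroStar :=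
  ⟨fun _ _ hmn => h.1 (Nat.div_le_div_right hmn),
    h.2.comp (Nat.tendsto_div_const_atTop two_ne_zero)⟩

theorem add_mem_cZeroStar {ξ η : ℕ → ℝ} (h : ξ ∈ cZeroStar) (h' : η ∈ cZeroStar) :
    ξ + η ∈ cZeroStar :=
  ⟨h.1.add h'.1, by simpa using! h.2.add h'.2⟩

theorem zero_mem_cZeroStar : (0 : ℕ → ℝ) ∈ cZeroStar :=
  ⟨antitone_const, tendsto_const_nhds⟩

/-- Characteristic sets: the hereditary cones in `c₀*` closed under dilation. -/
structure IsCharSet (S : Set (ℕ → ℝ)) : Prop where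
  subset : S ⊆ cZeroStar
  zero_mem : 0 ∈ S
  mono : ∀ {ξ η : ℕ → ℝ}, ξ ∈ cZeroStar → η ∈ S → (∀ n, ξ n ≤ η n) → ξ ∈ S
  add_mem : ∀ {ξ η : ℕ → ℝ}, ξ ∈ S → η ∈ S → ξ + η ∈ S
  dilate_mem : ∀ {ξ : ℕ → ℝ}, ξ ∈ S → dilate ξ ∈ S

theorem isCharSet_cZeroStar : IsCharSet cZeroStar where
  subset := subset_rfl
  zero_mem := zero_mem_cZeroStar
  mono h _ _ := h
  add_mem := add_mem_cZeroStar
  dilate_mem := dilate_mem_cZeroStar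

namespace IsCharSet

variable {S : Set (ℕ → ℝ)}

theorem nsmul_mem (hS : IsCharSet S) {ξ : ℕ → ℝ} (h : ξ ∈ S) (k : ℕ) : k • ξ ∈ S := by
  induction k with
  | zero => simpa using hS.zero_mem
  | succ k ih => rw [succ_nsmul]; exact hS.add_mem ih h

/-- Closure under sums gives natural multiples; heredity then handles a real `C` below a natural
number. -/
theorem mono_mul (hS : IsCharSet S) {ξ η : ℕ → ℝ} (hξ : ξ ∈ cZeroStar) (hη : η ∈ S) (C : ℝ)
    (h : ∀ n, ξ n ≤ C * η n) : ξ ∈ S := by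
  obtain ⟨k, hk⟩ := exists_nat_ge C
  refine hS.mono hξ (hS.nsmul_mem hη k) fun n => (h n).trans ?_
  simpa using mul_le_mul_of_nonneg_right hk (cZeroStar.nonneg (hS.subset hη) n)

end IsCharSet

/-! ### Arithmetic means of sequences. -/

theorem arithMean_mul (η : ℕ → ℝ) (n : ℕ) :
    arithMean η n * ((n : ℝ) + 1) = ∑ i ∈ Finset.range (n + 1), η i := by
  rw [arithMean, div_mul_cancel₀ _ (by positivity)]

theorem arithMean_add (ξ η : ℕ → ℝ) : arithMean (ξ + η) = arithMean ξ + arithMean η := by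
  ext n
  simp [arithMean, Finset.sum_add_distrib, add_div]

theorem arithMean_zero : arithMean 0 = 0 := by
  ext n
  simp [arithMean]

theorem arithMean_mono {ξ η : ℕ → ℝ} (h : ∀ n, ξ n ≤ η n) (n : ℕ) :
    arithMean ξ n ≤ arithMean η n :=
  div_le_div_of_nonneg_right (Finset.sum_le_sum fun i _ => h i) (by positivity)

theorem le_arithMean {ξ : ℕ → ℝ} (h : Antitone ξ) (n : ℕ) : ξ n ≤ arithMean ξ n := by
  rw [arithMean, le_div_iff₀ (by positivity)]
  have := Finset.card_nsmul_le_sum (Finset.range (n + 1)) ξ (ξ n)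
    fun i hi => h (Nat.lt_succ_iff.mp (Finset.mem_range.mp hi))
  simpa [mul_comm] using this

theorem arithMean_nonneg {ξ : ℕ → ℝ} (h : ξ ∈ cZeroStar) (n : ℕ) : 0 ≤ arithMean ξ n :=
  (cZeroStar.nonneg h n).trans (le_arithMean h.1 n)

theorem tendsto_arithMean {ξ : ℕ → ℝ} (h : Tendsto ξ atTop (𝓝 0)) :
    Tendsto (arithMean ξ) atTop (𝓝 0) := by
  refine ((tendsto_add_atTop_iff_nat 1).mpr h.cesaro).congr fun n => ?_
  simp [arithMean, div_eq_inv_mul]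

/-- The next mean is a weighted average of the current one and a new term that does not exceed it.
-/
theorem antitone_arithMean {ξ : ℕ → ℝ} (h : Antitone ξ) : Antitone (arithMean ξ) := by
  refine antitone_nat_of_succ_le fun n => ?_
  have h1 := arithMean_mul ξ n
  have h2 := arithMean_mul ξ (n + 1)
  rw [Finset.sum_range_succ, ← h1] at h2
  have h3 := (h n.le_succ).trans (le_arithMean h n)
  push_cast at h2
  have : (0 : ℝ) < (n : ℝ) + 1 + 1 := by positivity
  nlinarith

theorem arithMean_mem_cZeroStar {ξ : ℕ → ℝ} (h : ξ ∈ cZeroStar) : arithMean ξ ∈ cZeroStar :=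
  ⟨antitone_arithMean h.1, tendsto_arithMean h.2⟩

theorem sum_dilate_le {ξ : ℕ → ℝ} (h : ∀ n, 0 ≤ ξ n) (n : ℕ) :
    ∑ i ∈ Finset.range (n + 1), dilate ξ i ≤ 2 * ∑ i ∈ Finset.range (n / 2 + 1), ξ i := by
  have key (k : ℕ) :
      ∑ i ∈ Finset.range (2 * k), dilate ξ i = 2 * ∑ i ∈ Finset.range k, ξ i := by
    induction k with
    | zero => simp
    | succ k ih =>
      rw [mul_add, mul_one, Finset.sum_range_succ, Finset.sum_range_succ, ih,
        Finset.sum_range_succ, dilate, dilate, show 2 * k / 2 = k by omega,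
        show (2 * k + 1) / 2 = k by omega]
      ring
  rw [← key]
  exact Finset.sum_le_sum_of_subset_of_nonneg (Finset.range_mono (by omega)) fun i _ _ => h _

/-- This makes `preMeanSet` closed under dilation; the opposite comparison `dilate_arithMean_le`
does the same for `meanSet`. -/
theorem arithMean_dilate_le {ξ : ℕ → ℝ} (h : ∀ n, 0 ≤ ξ n) (n : ℕ) :
    arithMean (dilate ξ) n ≤ 2 * dilate (arithMean ξ) n := by
  have h1 := sum_dilate_le h n
  have h2 : 0 ≤ ∑ i ∈ Finset.range (n / 2 + 1), ξ i := Finset.sum_nonneg fun i _ => h i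
  rw [dilate, arithMean, arithMean, ← mul_div_assoc]
  gcongr
  exact_mod_cast Nat.div_le_self n 2

theorem dilate_arithMean_le {ξ : ℕ → ℝ} (h : ∀ n, 0 ≤ ξ n) (n : ℕ) :
    dilate (arithMean ξ) n ≤ 2 * arithMean ξ n := by
  rw [dilate, arithMean, arithMean, ← mul_div_assoc, div_le_div_iff₀ (by positivity) (by positivity),
    mul_right_comm]
  have h1 : ∑ i ∈ Finset.range (n / 2 + 1), ξ i ≤ ∑ i ∈ Finset.range (n + 1), ξ i :=
    Finset.sum_le_sum_of_subset_of_nonneg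
      (Finset.range_mono (Nat.succ_le_succ (Nat.div_le_self n 2))) fun i _ _ => h i
  have h2 : (n : ℝ) + 1 ≤ 2 * ((n / 2 : ℕ) + 1) := by
    exact_mod_cast (by omega : n + 1 ≤ 2 * (n / 2 + 1))
  rw [mul_comm]
  exact mul_le_mul h2 h1 (Finset.sum_nonneg fun i _ => h i) (by positivity)

/-- The sequences whose arithmetic mean lies in `S`. -/
def preMeanSet (S : Set (ℕ → ℝ)) : Set (ℕ → ℝ) := {ξ | ξ ∈ cZeroStar ∧ arithMean ξ ∈ S}

/-- The sequences in `c₀*` dominated by a multiple of an arithmetic mean of a member of `S`. -/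
def meanSet (S : Set (ℕ → ℝ)) : Set (ℕ → ℝ) :=
  {ξ | ξ ∈ cZeroStar ∧ ∃ η ∈ S, ∃ C : ℝ, ∀ n, ξ n ≤ C * arithMean η n}

theorem IsCharSet.preMeanSet {S : Set (ℕ → ℝ)} (hS : IsCharSet S) : IsCharSet (preMeanSet S) where
  subset _ h := h.1
  zero_mem := ⟨zero_mem_cZeroStar, by rw [arithMean_zero]; exact hS.zero_mem⟩
  mono h h' hle := ⟨h, hS.mono (arithMean_mem_cZeroStar h) h'.2 (arithMean_mono hle)⟩
  add_mem h h' := ⟨add_mem_cZeroStar h.1 h'.1, by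
    rw [arithMean_add]; exact hS.add_mem h.2 h'.2⟩
  dilate_mem h := ⟨dilate_mem_cZeroStar h.1,
    hS.mono_mul (arithMean_mem_cZeroStar (dilate_mem_cZeroStar h.1)) (hS.dilate_mem h.2) 2
      (arithMean_dilate_le (cZeroStar.nonneg h.1))⟩

theorem IsCharSet.meanSet {S : Set (ℕ → ℝ)} (hS : IsCharSet S) : IsCharSet (meanSet S) where
  subset _ h := h.1
  zero_mem := ⟨zero_mem_cZeroStar, 0, hS.zero_mem, 0, by simp⟩
  mono h h' hle := by
    obtain ⟨_, ζ, hζ, C, hC⟩ := h'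
    exact ⟨h, ζ, hζ, C, fun n => (hle n).trans (hC n)⟩
  add_mem h h' := by
    obtain ⟨h, ζ, hζ, C, hC⟩ := h
    obtain ⟨h', ζ', hζ', C', hC'⟩ := h'
    refine ⟨add_mem_cZeroStar h h', ζ + ζ', hS.add_mem hζ hζ', max C C', fun n => ?_⟩
    rw [arithMean_add, Pi.add_apply, Pi.add_apply, mul_add]
    exact add_le_add
      ((hC n).trans (mul_le_mul_of_nonneg_right (le_max_left _ _)
        (arithMean_nonneg (hS.subset hζ) n)))
      ((hC' n).trans (mul_le_mul_of_nonneg_right (le_max_right _ _)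
        (arithMean_nonneg (hS.subset hζ') n)))
  dilate_mem h := by
    obtain ⟨h, ζ, hζ, C, hC⟩ := h
    refine ⟨dilate_mem_cZeroStar h, ζ, hζ, |C| * 2, fun n => (hC (n / 2)).trans ?_⟩
    have h0 := cZeroStar.nonneg (hS.subset hζ)
    calc C * arithMean ζ (n / 2) ≤ |C| * arithMean ζ (n / 2) :=
          mul_le_mul_of_nonneg_right (le_abs_self C) (arithMean_nonneg (hS.subset hζ) _)
      _ ≤ |C| * (2 * arithMean ζ n) :=
          mul_le_mul_of_nonneg_left (dilate_arithMean_le h0 n) (abs_nonneg C)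
      _ = |C| * 2 * arithMean ζ n := by ring

/-! ### The envelope `omegaUnd` and the am-interior on the level of sequences. -/

theorem div_omega (ξ : ℕ → ℝ) (i : ℕ) : ξ i / omega i = ((i : ℝ) + 1) * ξ i := by
  rw [omega, div_div_eq_mul_div, div_one, mul_comm]

theorem omegaUnd_mul (ξ : ℕ → ℝ) (n : ℕ) :
    omegaUnd ξ n * ((n : ℝ) + 1) = partialSups (fun i => ξ i / omega i) n := by
  rw [omegaUnd, omega]
  field_simp

theorem omegaUnd_le_iff {ξ : ℕ → ℝ} {n : ℕ} {a : ℝ} :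
    omegaUnd ξ n ≤ a ↔ ∀ i ≤ n, ((i : ℝ) + 1) * ξ i ≤ a * ((n : ℝ) + 1) := by
  rw [← mul_le_mul_iff_left₀ (by positivity : (0 : ℝ) < (n : ℝ) + 1), omegaUnd_mul,
    partialSups_le_iff]
  simp only [div_omega]

theorem le_omegaUnd (ξ : ℕ → ℝ) (n : ℕ) : ξ n ≤ omegaUnd ξ n := by
  have := omegaUnd_le_iff.mp (le_refl (omegaUnd ξ n)) n le_rfl
  rw [mul_comm] at this
  exact le_of_mul_le_mul_right this (by positivity)

theorem antitone_omegaUnd {ξ : ℕ → ℝ} (h : ξ ∈ cZeroStar) : Antitone (omegaUnd ξ) := by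
  refine antitone_nat_of_succ_le fun n => omegaUnd_le_iff.mpr fun i hi => ?_
  have h0 := (cZeroStar.nonneg h n).trans (le_omegaUnd ξ n)
  rcases Nat.le_succ_iff.mp hi with hi | rfl
  · refine (omegaUnd_le_iff.mp le_rfl i hi).trans (mul_le_mul_of_nonneg_left ?_ h0)
    push_cast
    linarith
  · rw [mul_comm]
    exact mul_le_mul_of_nonneg_right ((h.1 n.le_succ).trans (le_omegaUnd ξ n)) (by positivity)

/-- After clearing denominators the right side is a partial sum of `η ≥ 0`, so the bound at an index
`i` persists at every `n ≥ i`. -/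
theorem omegaUnd_le_mul_arithMean {ξ η : ℕ → ℝ} (hη : ∀ n, 0 ≤ η n) {C : ℝ} (hC : 0 ≤ C)
    (h : ∀ n, ξ n ≤ C * arithMean η n) (n : ℕ) : omegaUnd ξ n ≤ C * arithMean η n := by
  refine omegaUnd_le_iff.mpr fun i hi => ?_
  rw [mul_assoc, arithMean_mul]
  calc ((i : ℝ) + 1) * ξ i ≤ ((i : ℝ) + 1) * (C * arithMean η i) := by gcongr; exact h i
    _ = C * (arithMean η i * ((i : ℝ) + 1)) := by ring
    _ ≤ C * ∑ i ∈ Finset.range (n + 1), η i := by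
      rw [arithMean_mul]
      refine mul_le_mul_of_nonneg_left ?_ hC
      exact Finset.sum_le_sum_of_subset_of_nonneg (Finset.range_mono (by omega)) fun i _ _ => hη i

theorem omegaUnd_mem_cZeroStar {ξ : ℕ → ℝ} (h : ξ ∈ cZeroStar) : omegaUnd ξ ∈ cZeroStar := by
  refine mem_cZeroStar_of_le (antitone_omegaUnd h)
    (fun n => (cZeroStar.nonneg h n).trans (le_omegaUnd ξ n)) (tendsto_arithMean h.2) fun n => ?_
  have := omegaUnd_le_mul_arithMean (cZeroStar.nonneg h) zero_le_one
    (fun n => by simpa using le_arithMean h.1 n) n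
  simpa using this

/-- Up to a factor `2`, `ω · und (ξ / ω)` is the arithmetic mean of a sequence in `c₀*`: take the
increments of a concave majorant of the quasi-concave sequence `und (ξ / ω)`. -/
theorem exists_arithMean_equiv_omegaUnd {ξ : ℕ → ℝ} (h : ξ ∈ cZeroStar) :
    ∃ η ∈ cZeroStar, ∀ n, omegaUnd ξ n ≤ arithMean η n ∧ arithMean η n ≤ 2 * omegaUnd ξ n := by
  set z := omegaUnd ξ with hz
  have hz0 := cZeroStar.nonneg (omegaUnd_mem_cZeroStar h)
  -- Each `a k` is affine in `n`, so the infimum `K` is concave. It majorizes `z n * (n + 1)`: for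
  -- `k ≤ n` the second summand suffices since `z` decreases, for `k ≥ n` the first since `z k * (k
  -- + 1)` increases. Taking `k = n` costs the factor 2.
  let a : ℕ → ℕ → ℝ := fun k n => z k * ((k : ℝ) + 1 + ((n : ℝ) + 1))
  have ha0 (k n) : 0 ≤ a k n := mul_nonneg (hz0 k) (by positivity)
  have hbdd (n) : BddBelow (Set.range fun k => a k n) := ⟨0, by rintro _ ⟨k, rfl⟩; exact ha0 k n⟩
  let K : ℕ → ℝ := fun n => ⨅ k, a k n
  have hKle (k n) : K n ≤ a k n := ciInf_le (hbdd n) k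
  have hMK (n) : z n * ((n : ℝ) + 1) ≤ K n := by
    refine le_ciInf fun k => ?_
    rcases le_total k n with hkn | hkn
    · have := (antitone_omegaUnd h) hkn
      have h2 := hz0 k
      have : z n * ((n : ℝ) + 1) ≤ z k * ((n : ℝ) + 1) := by gcongr
      refine this.trans (mul_le_mul_of_nonneg_left (le_add_of_nonneg_left (by positivity)) h2)
    · have h1 : z n * ((n : ℝ) + 1) ≤ z k * ((k : ℝ) + 1) := by
        rw [hz, omegaUnd_mul, omegaUnd_mul]
        exact (partialSups _).monotone hkn
      exact h1.trans (mul_le_mul_of_nonneg_left (le_add_of_nonneg_right (by positivity)) (hz0 k))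
  have hK2 (n) : K n ≤ 2 * (z n * ((n : ℝ) + 1)) := (hKle n n).trans (by simp only [a]; linarith)
  have hKmono (n) : K n ≤ K (n + 1) := by
    refine le_ciInf fun k => (hKle k n).trans (mul_le_mul_of_nonneg_left ?_ (hz0 k))
    push_cast
    linarith
  have hconc (n) : K (n + 2) + K n ≤ 2 * K (n + 1) := by
    suffices (K (n + 2) + K n) / 2 ≤ K (n + 1) by linarith
    refine le_ciInf fun k => ?_
    have h1 := hKle k n
    have h2 := hKle k (n + 2)
    simp only [a] at h1 h2 ⊢
    push_cast at h1 h2 ⊢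
    linarith
  -- Concavity at the left end, with value `0` at index `-1`; it says `η 1 ≤ η 0` for the increments
  -- below.
  have hconc0 : K 1 ≤ 2 * K 0 := by
    suffices K 1 / 2 ≤ K 0 by linarith
    refine le_ciInf fun k => ?_
    have h1 := hKle k 1
    have h2 : 0 ≤ z k * ((k : ℝ) + 1) := mul_nonneg (hz0 k) (by positivity)
    simp only [a] at h1 ⊢
    push_cast at h1 ⊢
    linarith
  let η : ℕ → ℝ := fun n => n.casesOn (K 0) fun m => K (m + 1) - K m
  have hsum (n) : ∑ i ∈ Finset.range (n + 1), η i = K n := by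
    induction n with
    | zero => simp [η]
    | succ n ih => rw [Finset.sum_range_succ, ih]; simp [η]
  have hmean (n) : z n ≤ arithMean η n ∧ arithMean η n ≤ 2 * z n := by
    have hn : (0 : ℝ) < (n : ℝ) + 1 := by positivity
    rw [arithMean, hsum, le_div_iff₀ hn, div_le_iff₀ hn, mul_assoc]
    exact ⟨hMK n, hK2 n⟩
  have hanti : Antitone η := by
    refine antitone_nat_of_succ_le fun n => ?_
    cases n with
    | zero => exact (by linarith : K (0 + 1) - K 0 ≤ K 0)
    | succ n => simp only [η]; linarith [hconc n]
  have h0 (n) : 0 ≤ η n := by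
    cases n with
    | zero => exact le_trans (mul_nonneg (hz0 0) (by positivity)) (hMK 0)
    | succ n => simp only [η]; linarith [hKmono n]
  refine ⟨η, mem_cZeroStar_of_le hanti h0 (η := fun n => 2 * z n) ?_
    fun n => (le_arithMean hanti n).trans (hmean n).2, hmean⟩
  simpa using (omegaUnd_mem_cZeroStar h).2.const_mul 2

theorem meanSet_preMeanSet {S : Set (ℕ → ℝ)} (hS : IsCharSet S) :
    meanSet (preMeanSet S) = {ξ | ξ ∈ cZeroStar ∧ omegaUnd ξ ∈ S} := by
  ext ξ
  constructor
  · rintro ⟨hξ, η, ⟨hη, hηS⟩, C, hC⟩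
    refine ⟨hξ, hS.mono_mul (omegaUnd_mem_cZeroStar hξ) hηS |C| ?_⟩
    exact omegaUnd_le_mul_arithMean (cZeroStar.nonneg hη) (abs_nonneg C) fun n =>
      (hC n).trans (mul_le_mul_of_nonneg_right (le_abs_self C) (arithMean_nonneg hη n))
  · rintro ⟨hξ, hζ⟩
    obtain ⟨η, hη, h⟩ := exists_arithMean_equiv_omegaUnd hξ
    refine ⟨hξ, η, ⟨hη, hS.mono_mul (arithMean_mem_cZeroStar hη) hζ 2 fun n => (h n).2⟩, 1,
      fun n => ?_⟩
    simpa using (le_omegaUnd ξ n).trans (h n).1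

/-! ### Inequalities for `s`-numbers. -/

section SNumbers

variable {H : Type*} [NormedAddCommGroup H] [InnerProductSpace ℂ H]

theorem bddBelow_norm_sub (X : H →L[ℂ] H) (n : ℕ) : BddBelow (Set.range
    fun F : {F : H →L[ℂ] H // LinearMap.rank (F : H →ₗ[ℂ] H) ≤ (n : Cardinal)} => ‖X - F.1‖) :=
  ⟨0, by rintro _ ⟨F, rfl⟩; exact norm_nonneg _⟩

theorem sNumbers_le {X F : H →L[ℂ] H} {n : ℕ}
    (hF : LinearMap.rank (F : H →ₗ[ℂ] H) ≤ (n : Cardinal)) : sNumbers X n ≤ ‖X - F‖ :=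
  ciInf_le (bddBelow_norm_sub X n) ⟨F, hF⟩

instance nonempty_rank_le (n : ℕ) :
    Nonempty {F : H →L[ℂ] H // LinearMap.rank (F : H →ₗ[ℂ] H) ≤ (n : Cardinal)} :=
  ⟨0, by simp⟩

theorem le_sNumbers {X : H →L[ℂ] H} {n : ℕ} {a : ℝ}
    (h : ∀ F : H →L[ℂ] H, LinearMap.rank (F : H →ₗ[ℂ] H) ≤ (n : Cardinal) → a ≤ ‖X - F‖) :
    a ≤ sNumbers X n :=
  le_ciInf fun F => h F.1 F.2

theorem exists_norm_sub_lt {X : H →L[ℂ] H} {n : ℕ} {a : ℝ} (h : sNumbers X n < a) :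
    ∃ F : H →L[ℂ] H, LinearMap.rank (F : H →ₗ[ℂ] H) ≤ (n : Cardinal) ∧ ‖X - F‖ < a := by
  obtain ⟨F, hF⟩ := exists_lt_of_ciInf_lt h
  exact ⟨F.1, F.2, hF⟩

theorem sNumbers_nonneg (X : H →L[ℂ] H) (n : ℕ) : 0 ≤ sNumbers X n :=
  le_sNumbers fun _ _ => norm_nonneg _

theorem antitone_sNumbers (X : H →L[ℂ] H) : Antitone (sNumbers X) := fun m n hmn =>
  le_sNumbers fun _ hF => sNumbers_le (hF.trans (by exact_mod_cast hmn))

theorem sNumbers_zero : sNumbers (0 : H →L[ℂ] H) = 0 := by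
  ext n
  refine le_antisymm ?_ (sNumbers_nonneg _ _)
  simpa using sNumbers_le (X := (0 : H →L[ℂ] H)) (F := 0) (n := n) (by simp)

theorem sNumbers_mul_left_le (A X : H →L[ℂ] H) (n : ℕ) :
    sNumbers (A * X) n ≤ ‖A‖ * sNumbers X n := by
  refine le_of_forall_pos_le_add fun ε hε => ?_
  -- The added `1` keeps the division meaningful when `A = 0`.
  have hA : 0 < ‖A‖ + 1 := by positivity
  obtain ⟨F, hF, hlt⟩ := exists_norm_sub_lt (X := X) (n := n)
    (a := sNumbers X n + ε / (‖A‖ + 1)) (by linarith [div_pos hε hA])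
  refine (sNumbers_le (F := A * F) ?_).trans ?_
  · exact (LinearMap.rank_comp_le_right (F : H →ₗ[ℂ] H) (A : H →ₗ[ℂ] H)).trans hF
  · rw [← mul_sub]
    calc ‖A * (X - F)‖ ≤ ‖A‖ * (sNumbers X n + ε / (‖A‖ + 1)) :=
          (norm_mul_le _ _).trans (by gcongr)
      _ = ‖A‖ * sNumbers X n + ε * (‖A‖ / (‖A‖ + 1)) := by ring
      _ ≤ ‖A‖ * sNumbers X n + ε * 1 := by
          gcongr
          exact (div_le_one hA).mpr (by linarith)
      _ = _ := by ring

theorem sNumbers_mul_right_le (X A : H →L[ℂ] H) (n : ℕ) :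
    sNumbers (X * A) n ≤ ‖A‖ * sNumbers X n := by
  refine le_of_forall_pos_le_add fun ε hε => ?_
  have hA : 0 < ‖A‖ + 1 := by positivity
  obtain ⟨F, hF, hlt⟩ := exists_norm_sub_lt (X := X) (n := n)
    (a := sNumbers X n + ε / (‖A‖ + 1)) (by linarith [div_pos hε hA])
  refine (sNumbers_le (F := F * A) ?_).trans ?_
  · exact (LinearMap.rank_comp_le_left (A : H →ₗ[ℂ] H) (F : H →ₗ[ℂ] H)).trans hF
  · rw [← sub_mul]
    calc ‖(X - F) * A‖ ≤ (sNumbers X n + ε / (‖A‖ + 1)) * ‖A‖ :=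
          (norm_mul_le _ _).trans (by gcongr)
      _ = ‖A‖ * sNumbers X n + ε * (‖A‖ / (‖A‖ + 1)) := by ring
      _ ≤ ‖A‖ * sNumbers X n + ε * 1 := by
          gcongr
          exact (div_le_one hA).mpr (by linarith)
      _ = _ := by ring

theorem sNumbers_add_le (X Y : H →L[ℂ] H) (m n : ℕ) :
    sNumbers (X + Y) (m + n) ≤ sNumbers X m + sNumbers Y n := by
  refine le_of_forall_pos_le_add fun ε hε => ?_
  obtain ⟨F, hF, hFlt⟩ := exists_norm_sub_lt (X := X) (n := m)
    (a := sNumbers X m + ε / 2) (by linarith)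
  obtain ⟨G, hG, hGlt⟩ := exists_norm_sub_lt (X := Y) (n := n)
    (a := sNumbers Y n + ε / 2) (by linarith)
  refine (sNumbers_le (F := F + G) ?_).trans ?_
  · push_cast
    exact (LinearMap.rank_add_le (F : H →ₗ[ℂ] H) (G : H →ₗ[ℂ] H)).trans (add_le_add hF hG)
  · rw [add_sub_add_comm]
    linarith [norm_add_le (X - F) (Y - G)]

/-- Ranks of approximants add up, so each summand gets half of the rank. Hence closure under
dilation is what makes sums stay in an ideal. -/
theorem sNumbers_add_le_dilate (X Y : H →L[ℂ] H) (n : ℕ) :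
    sNumbers (X + Y) n ≤ dilate (sNumbers X + sNumbers Y) n :=
  (antitone_sNumbers _ (by omega : n / 2 + n / 2 ≤ n)).trans (sNumbers_add_le X Y _ _)

end SNumbers

/-! ### Diagonal operators with respect to orthonormal sequences. -/

/-- The sequence space `ℓ²`. -/
abbrev EllTwo : Type := lp (fun _ : ℕ => ℂ) 2

/-- A bounded sequence of real numbers. -/
def IsBdd (c : ℕ → ℝ) : Prop := ∃ C, ∀ n, |c n| ≤ C

theorem IsBdd.mul {c d : ℕ → ℝ} (hc : IsBdd c) (hd : IsBdd d) : IsBdd (c * d) := by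
  obtain ⟨C, hC⟩ := hc
  obtain ⟨D, hD⟩ := hd
  refine ⟨C * D, fun n => ?_⟩
  rw [Pi.mul_apply, abs_mul]
  exact mul_le_mul (hC n) (hD n) (abs_nonneg _) ((abs_nonneg _).trans (hC n))

theorem IsBdd.add {c d : ℕ → ℝ} (hc : IsBdd c) (hd : IsBdd d) : IsBdd (c + d) := by
  obtain ⟨C, hC⟩ := hc
  obtain ⟨D, hD⟩ := hd
  exact ⟨C + D, fun n => (abs_add_le _ _).trans (add_le_add (hC n) (hD n))⟩

theorem isBdd_one : IsBdd 1 := ⟨1, by simp⟩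

theorem isBdd_of_mem {ξ : ℕ → ℝ} (h : ξ ∈ cZeroStar) : IsBdd ξ :=
  ⟨ξ 0, fun n => by rw [abs_of_nonneg (cZeroStar.nonneg h n)]; exact h.1 n.zero_le⟩

theorem norm_rpow_mul_le {c : ℕ → ℝ} {C : ℝ} (hC : ∀ n, |c n| ≤ C) (x : ℕ → ℂ) (n : ℕ) :
    ‖(c n : ℂ) * x n‖ ^ (2 : ENNReal).toReal ≤ C ^ (2 : ENNReal).toReal *
      ‖x n‖ ^ (2 : ENNReal).toReal := by
  have h0 := (abs_nonneg _).trans (hC 0)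
  rw [← Real.mul_rpow h0 (norm_nonneg _)]
  refine Real.rpow_le_rpow (norm_nonneg _) ?_ (by simp)
  rw [norm_mul, Complex.norm_real]
  exact mul_le_mul_of_nonneg_right (hC n) (norm_nonneg _)

/-- Multiplication by a sequence, as a linear map on `ℓ²`. -/
def mulLin (c : ℕ → ℝ) (hc : IsBdd c) : EllTwo →ₗ[ℂ] EllTwo where
  toFun x := ⟨fun n => (c n : ℂ) * x n, by
    obtain ⟨C, hC⟩ := hc
    refine memℓp_gen (Summable.of_nonneg_of_le (fun n => by positivity)
      (norm_rpow_mul_le hC x) (((lp.memℓp x).summable (by simp)).mul_left _))⟩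
  map_add' x y := by
    ext n
    exact mul_add _ _ _
  map_smul' a x := by
    ext n
    exact mul_left_comm _ _ _

theorem norm_mulLin_le {c : ℕ → ℝ} (hc : IsBdd c) {C : ℝ} (hC : ∀ n, |c n| ≤ C) (x : EllTwo) :
    ‖mulLin c hc x‖ ≤ C * ‖x‖ := by
  have h0 := (abs_nonneg _).trans (hC 0)
  refine lp.norm_le_of_tsum_le (by simp) (by positivity) ?_
  rw [Real.mul_rpow h0 (norm_nonneg _), lp.norm_rpow_eq_tsum (by simp), ← tsum_mul_left]
  exact Summable.tsum_le_tsum (norm_rpow_mul_le hC x) ((lp.memℓp _).summable (by simp))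
    (((lp.memℓp x).summable (by simp)).mul_left _)

/-- Multiplication by a bounded sequence, as an operator on `ℓ²`. -/
def mulOp (c : ℕ → ℝ) (hc : IsBdd c) : EllTwo →L[ℂ] EllTwo :=
  (mulLin c hc).mkContinuous hc.choose (norm_mulLin_le hc hc.choose_spec)

theorem mulOp_apply {c : ℕ → ℝ} (hc : IsBdd c) (x : EllTwo) (n : ℕ) :
    mulOp c hc x n = c n * x n := rfl

theorem mulOp_one : mulOp 1 isBdd_one = 1 := by
  ext x n
  simp [mulOp_apply]

theorem mulOp_comp {c d : ℕ → ℝ} (hc : IsBdd c) (hd : IsBdd d) :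
    mulOp c hc ∘L mulOp d hd = mulOp (c * d) (hc.mul hd) := by
  ext x n
  simp [mulOp_apply, mul_assoc]

theorem mulOp_add {c d : ℕ → ℝ} (hc : IsBdd c) (hd : IsBdd d) :
    mulOp c hc + mulOp d hd = mulOp (c + d) (hc.add hd) := by
  ext x n
  simp [mulOp_apply, add_mul]

section Diagonal

variable {H : Type*} [NormedAddCommGroup H] [InnerProductSpace ℂ H] [CompleteSpace H]
variable {e f g : ℕ → H}

/-- The isometry of `ℓ²` into `H` determined by an orthonormal sequence. -/
def isom (he : Orthonormal ℂ e) : EllTwo →L[ℂ] H :=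
  he.orthogonalFamily.linearIsometry.toContinuousLinearMap

theorem isom_single (he : Orthonormal ℂ e) (n : ℕ) (a : ℂ) :
    isom he (lp.single 2 n a) = a • e n := by
  simp [isom, OrthogonalFamily.linearIsometry_apply_single]

theorem norm_isom (he : Orthonormal ℂ e) (x : EllTwo) : ‖isom he x‖ = ‖x‖ :=
  he.orthogonalFamily.linearIsometry.norm_map x

theorem norm_isom_le (he : Orthonormal ℂ e) : ‖isom he‖ ≤ 1 :=
  ContinuousLinearMap.opNorm_le_bound _ zero_le_one fun x => by rw [norm_isom, one_mul]

theorem hasSum_isom (he : Orthonormal ℂ e) (x : EllTwo) :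
    HasSum (fun n => x n • e n) (isom he x) := by
  simpa [isom] using he.orthogonalFamily.hasSum_linearIsometry x

theorem adjoint_isom_apply (he : Orthonormal ℂ e) (v : H) (n : ℕ) :
    (isom he).adjoint v n = ⟪e n, v⟫_ℂ := by
  have h := lp.inner_single_left (𝕜 := ℂ) n (1 : ℂ) ((isom he).adjoint v)
  rw [ContinuousLinearMap.adjoint_inner_right, isom_single, one_smul] at h
  simpa using h.symm

theorem adjoint_isom_comp_isom (he : Orthonormal ℂ e) : (isom he).adjoint ∘L isom he = 1 :=
  ContinuousLinearMap.norm_map_iff_adjoint_comp_self _ |>.mp (norm_isom he)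

omit [CompleteSpace H] in
theorem ellTwo_ext {A B : EllTwo →L[ℂ] H}
    (h : ∀ n, A (lp.single 2 n 1) = B (lp.single 2 n 1)) : A = B := by
  refine lp.ext_continuousLinearMap (by simp) fun n => ?_
  ext
  simpa using h n

theorem mulOp_single {c : ℕ → ℝ} (hc : IsBdd c) (n : ℕ) :
    mulOp c hc (lp.single 2 n 1) = lp.single 2 n (c n : ℂ) := by
  ext m
  rw [mulOp_apply]
  rcases eq_or_ne m n with rfl | h
  · simp
  · simp [h]

/-- If `X` maps one orthonormal sequence to multiples of another one, then it acts diagonally. -/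
theorem comp_isom_eq {X : H →L[ℂ] H} (he : Orthonormal ℂ e) (hf : Orthonormal ℂ f) {c : ℕ → ℝ}
    (hc : IsBdd c) (h : ∀ n, X (e n) = (c n : ℂ) • f n) :
    X ∘L isom he = isom hf ∘L mulOp c hc := by
  refine ellTwo_ext fun n => ?_
  simp [mulOp_single, isom_single, h]

/-- The operator `∑ c n ⟪e n, ·⟫ f n`. -/
def diagOp {c : ℕ → ℝ} (hc : IsBdd c) (he : Orthonormal ℂ e) (hf : Orthonormal ℂ f) :
    H →L[ℂ] H :=
  isom hf ∘L mulOp c hc ∘L (isom he).adjoint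

theorem diagOp_congr {c d : ℕ → ℝ} (hc : IsBdd c) (hd : IsBdd d) (he : Orthonormal ℂ e)
    (hf : Orthonormal ℂ f) (h : c = d) : diagOp hc he hf = diagOp hd he hf := by
  subst h
  rfl

theorem hasSum_diagOp {c : ℕ → ℝ} (hc : IsBdd c) (he : Orthonormal ℂ e) (hf : Orthonormal ℂ f)
    (v : H) : HasSum (fun n => ((c n : ℂ) * ⟪e n, v⟫_ℂ) • f n) (diagOp hc he hf v) := by
  have := hasSum_isom hf (mulOp c hc ((isom he).adjoint v))
  simp only [mulOp_apply, adjoint_isom_apply] at this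
  exact this

theorem diagOp_mul {c d : ℕ → ℝ} (hc : IsBdd c) (hd : IsBdd d) (he : Orthonormal ℂ e)
    (hf : Orthonormal ℂ f) (hg : Orthonormal ℂ g) :
    diagOp hc hf hg * diagOp hd he hf = diagOp (hc.mul hd) he hg := by
  rw [diagOp, diagOp, diagOp, ← mulOp_comp hc hd]
  ext v
  have h (x) : (isom hf).adjoint (isom hf x) = x :=
    DFunLike.congr_fun (adjoint_isom_comp_isom hf) x
  simp [h]

theorem diagOp_add {c d : ℕ → ℝ} (hc : IsBdd c) (hd : IsBdd d) (he : Orthonormal ℂ e)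
    (hf : Orthonormal ℂ f) :
    diagOp hc he hf + diagOp hd he hf = diagOp (hc.add hd) he hf := by
  rw [diagOp, diagOp, diagOp, ← mulOp_add hc hd]
  ext v
  simp

theorem norm_diagOp_le {c : ℕ → ℝ} (hc : IsBdd c) (he : Orthonormal ℂ e) (hf : Orthonormal ℂ f)
    {C : ℝ} (hC : ∀ n, |c n| ≤ C) : ‖diagOp hc he hf‖ ≤ C := by
  have h0 := (abs_nonneg _).trans (hC 0)
  refine ContinuousLinearMap.opNorm_le_bound _ h0 fun v => ?_
  rw [diagOp, ContinuousLinearMap.comp_apply, norm_isom]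
  refine (norm_mulLin_le hc hC _).trans (mul_le_mul_of_nonneg_left ?_ h0)
  refine ((isom he).adjoint.le_of_opNorm_le ?_ v).trans_eq (one_mul _)
  rw [LinearIsometryEquiv.norm_map]
  exact norm_isom_le he

theorem diagOp_apply_self {c : ℕ → ℝ} (hc : IsBdd c) (he : Orthonormal ℂ e)
    (hf : Orthonormal ℂ f) (n : ℕ) : diagOp hc he hf (e n) = (c n : ℂ) • f n := by
  have h : isom he (lp.single 2 n 1) = e n := by rw [isom_single, one_smul]
  have h' : (isom he).adjoint (isom he (lp.single 2 n 1)) = lp.single 2 n 1 :=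
    DFunLike.congr_fun (adjoint_isom_comp_isom he) _
  rw [diagOp, ContinuousLinearMap.comp_apply, ContinuousLinearMap.comp_apply, ← h, h',
    mulOp_single, isom_single]

/-- A finitely supported diagonal operator has finite rank. -/
theorem rank_diagOp_le {c : ℕ → ℝ} (hc : IsBdd c) (he : Orthonormal ℂ e) (hf : Orthonormal ℂ f)
    {n : ℕ} (h : ∀ i, n ≤ i → c i = 0) :
    LinearMap.rank (diagOp hc he hf : H →ₗ[ℂ] H) ≤ (n : Cardinal) := by
  classical
  have hle : LinearMap.range (diagOp hc he hf : H →ₗ[ℂ] H) ≤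
      Submodule.span ℂ (((Finset.range n).image f : Finset H) : Set H) := by
    rintro _ ⟨v, rfl⟩
    have h1 := hasSum_diagOp hc he hf v
    have h2 : HasSum (fun n => ((c n : ℂ) * ⟪e n, v⟫_ℂ) • f n)
        (∑ n ∈ Finset.range n, ((c n : ℂ) * ⟪e n, v⟫_ℂ) • f n) :=
      hasSum_sum_of_ne_finset_zero fun i hi => by simp [h i (by simpa using hi)]
    change diagOp hc he hf v ∈ _
    rw [h1.unique h2]
    exact Submodule.sum_mem _ fun i hi => Submodule.smul_mem _ _
      (Submodule.subset_span (by simpa using ⟨i, by simpa using hi, rfl⟩))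
  refine (Submodule.rank_mono hle).trans ((rank_span_finset_le _).trans ?_)
  exact_mod_cast Finset.card_image_le.trans (by simp)

omit [CompleteSpace H] in
theorem norm_sq_sum_smul {ι : Type*} (s : Finset ι) {u : ι → H} (hu : Orthonormal ℂ u)
    (a : ι → ℂ) : ‖∑ i ∈ s, a i • u i‖ ^ 2 = ∑ i ∈ s, ‖a i‖ ^ 2 := by
  have h := hu.inner_sum a a s
  rw [inner_self_eq_norm_sq_to_K] at h
  have h' : ∀ i, (starRingEnd ℂ) (a i) * a i = ((‖a i‖ ^ 2 : ℝ) : ℂ) := fun i => by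
    rw [RCLike.conj_mul]; push_cast; rfl
  simp only [h', ← Complex.ofReal_sum] at h
  exact Complex.ofReal_injective (by simpa using h)

omit [CompleteSpace H] in
-- By dimension, an `F` of rank at most `n` kills a nonzero vector in the span of `e 0, …, e n`, and
-- there `X` stretches norms by at least `t n`.
theorem le_sNumbers_of_apply {X : H →L[ℂ] H} (he : Orthonormal ℂ e) (hf : Orthonormal ℂ f)
    {t : ℕ → ℝ} (ht : Antitone t) (h0 : ∀ n, 0 ≤ t n) (h : ∀ n, X (e n) = (t n : ℂ) • f n)
    (n : ℕ) : t n ≤ sNumbers X n := by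
  refine le_sNumbers fun F hF => ?_
  let W : (Fin (n + 1) → ℂ) →ₗ[ℂ] H := Fintype.linearCombination ℂ fun i : Fin (n + 1) => e i
  have hW (a) : W a = ∑ i, a i • e i := Fintype.linearCombination_apply ..
  have he' : Orthonormal ℂ fun i : Fin (n + 1) => e i := he.comp _ Fin.val_injective
  have hf' : Orthonormal ℂ fun i : Fin (n + 1) => f i := hf.comp _ Fin.val_injective
  obtain ⟨a, ha, ha0⟩ : ∃ a : Fin (n + 1) → ℂ, F (W a) = 0 ∧ a ≠ 0 := by
    by_contra! hcon
    have hinj : Function.Injective ((F : H →ₗ[ℂ] H).rangeRestrict ∘ₗ W) := by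
      rw [← LinearMap.ker_eq_bot, LinearMap.ker_eq_bot']
      exact fun a ha => hcon a (congrArg Subtype.val ha)
    have h1 := LinearMap.lift_rank_le_of_injective _ hinj
    have h2 := h1.trans (Cardinal.lift_le.mpr hF)
    simp only [rank_fun', Fintype.card_fin, Cardinal.lift_natCast, Nat.cast_le] at h2
    omega
  have hXW : X (W a) = ∑ i : Fin (n + 1), (a i * t i) • f i := by
    simp only [hW, map_sum, map_smul, h, smul_smul]
  have hv : ‖W a‖ ^ 2 = ∑ i, ‖a i‖ ^ 2 := by rw [hW, norm_sq_sum_smul _ he']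
  have hpos : 0 < ‖W a‖ := by
    obtain ⟨i, hi⟩ := Function.ne_iff.mp ha0
    have hi' : a i ≠ 0 := hi
    have hsum : 0 < ‖W a‖ ^ 2 := by
      rw [hv]
      exact Finset.sum_pos' (fun _ _ => by positivity) ⟨i, Finset.mem_univ i, by positivity⟩
    exact (norm_nonneg _).lt_of_ne fun h' => by simp [← h'] at hsum
  have hle : t n * ‖W a‖ ≤ ‖X (W a)‖ := by
    refine (sq_le_sq₀ (mul_nonneg (h0 n) hpos.le) (norm_nonneg _)).mp ?_
    rw [mul_pow, hv, hXW, norm_sq_sum_smul _ hf', Finset.mul_sum]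
    refine Finset.sum_le_sum fun i _ => ?_
    rw [norm_mul, mul_pow, mul_comm, Complex.norm_real, Real.norm_of_nonneg (h0 i)]
    gcongr
    · exact h0 n
    · exact ht (Nat.lt_succ_iff.mp i.2)
  have hXF : ‖X (W a)‖ ≤ ‖X - F‖ * ‖W a‖ := by
    simpa [ha] using (X - F).le_opNorm (W a)
  exact le_of_mul_le_mul_right (hle.trans hXF) hpos

/-- For the upper bound, truncation to the first `n` coefficients has rank at most `n` and leaves a
tail of norm at most `ξ n`. -/
theorem sNumbers_diagOp {ξ : ℕ → ℝ} (hξ : ξ ∈ cZeroStar) (he : Orthonormal ℂ e)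
    (hf : Orthonormal ℂ f) : sNumbers (diagOp (isBdd_of_mem hξ) he hf) = ξ := by
  have h0 := cZeroStar.nonneg hξ
  ext n
  refine le_antisymm ?_ (le_sNumbers_of_apply he hf hξ.1 h0 (diagOp_apply_self _ he hf) n)
  let c : ℕ → ℝ := fun i => if i < n then ξ i else 0
  let d : ℕ → ℝ := fun i => if i < n then 0 else ξ i
  have hd' (i) : |d i| ≤ ξ n := by
    by_cases hi : i < n
    · simpa [d, hi] using h0 n
    · simpa [d, hi, abs_of_nonneg (h0 i)] using hξ.1 (not_lt.mp hi)
  have hc : IsBdd c := ⟨ξ 0, fun i => by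
    by_cases hi : i < n
    · simpa [c, hi, abs_of_nonneg (h0 i)] using hξ.1 i.zero_le
    · simpa [c, hi] using h0 0⟩
  have hd : IsBdd d := ⟨ξ n, hd'⟩
  have hsum : diagOp (isBdd_of_mem hξ) he hf = diagOp hc he hf + diagOp hd he hf := by
    rw [diagOp_add]
    refine diagOp_congr _ _ he hf (funext fun i => ?_)
    by_cases hi : i < n <;> simp [c, d, hi]
  refine (sNumbers_le (F := diagOp hc he hf) (rank_diagOp_le hc he hf fun i hi => ?_)).trans ?_
  · simp [c, not_lt.mpr hi]
  · rw [hsum, add_sub_cancel_left]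
    exact norm_diagOp_le hd he hf hd'

end Diagonal

/-! ### Singular value decomposition, and noncompact operators. -/

section Sequences

variable {H : Type*} [NormedAddCommGroup H] [InnerProductSpace ℂ H] [CompleteSpace H]

/-- A separable infinite-dimensional Hilbert space has an orthonormal basis indexed by `ℕ`. -/
theorem exists_hilbertBasis_nat [TopologicalSpace.SeparableSpace H]
    (hH : ¬ FiniteDimensional ℂ H) : Nonempty (HilbertBasis ℕ ℂ H) := by
  obtain ⟨w, b, hb⟩ := exists_hilbertBasis ℂ H
  -- The distance is `√2`; the bound `1` already makes the balls of radius `1/2` disjoint, so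
  -- separability leaves only countably many.
  have hdist : ∀ i j : w, i ≠ j → 1 ≤ ‖b i - b j‖ := fun i j hij => by
    have h := norm_sub_sq (𝕜 := ℂ) (b i) (b j)
    rw [b.orthonormal.2 hij, b.orthonormal.1 i, b.orthonormal.1 j] at h
    norm_num at h
    nlinarith [norm_nonneg (b i - b j)]
  have hcount : Countable w := by
    refine Pairwise.countable_of_isOpen_disjoint (s := fun i : w => Metric.ball (b i) (1 / 2))
      (fun i j hij => ?_) (fun _ => Metric.isOpen_ball) fun i => ⟨b i, by simp⟩
    refine Metric.ball_disjoint_ball ?_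
    rw [dist_eq_norm]
    linarith [hdist i j hij]
  have hinf : Infinite w := by
    by_contra hfin
    rw [not_infinite_iff_finite] at hfin
    have := Fintype.ofFinite w
    exact hH (b.toOrthonormalBasis.toBasis.finiteDimensional_of_finite)
  obtain ⟨φ⟩ : Nonempty (ℕ ≃ w) := by
    have := Encodable.ofCountable w
    have := Denumerable.ofEncodableOfInfinite w
    exact ⟨(Denumerable.eqv w).symm⟩
  refine ⟨HilbertBasis.mk (v := b ∘ φ) (b.orthonormal.comp φ φ.injective) ?_⟩
  rw [φ.surjective.range_comp, b.dense_span]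

theorem isom_comp_adjoint (b : HilbertBasis ℕ ℂ H) :
    isom b.orthonormal ∘L (isom b.orthonormal).adjoint = 1 := by
  ext v
  refine (hasSum_isom b.orthonormal _).unique ?_
  simpa [adjoint_isom_apply, b.repr_apply_apply] using b.hasSum_repr v

omit [CompleteSpace H] in
theorem nontrivial_orthogonal_span (hH : ¬ FiniteDimensional ℂ H) (s : Finset H) :
    Nontrivial (Submodule.span ℂ (s : Set H))ᗮ := by
  rw [Submodule.nontrivial_iff_ne_bot]
  intro h
  rw [Submodule.orthogonal_eq_bot_iff] at h
  exact hH (Module.finite_def.mpr ⟨s, h⟩)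

omit [CompleteSpace H] in
theorem mem_orthogonal_span_iff {s : Set H} {v : H} :
    v ∈ (Submodule.span ℂ s)ᗮ ↔ ∀ u ∈ s, ⟪u, v⟫_ℂ = 0 := by
  refine ⟨fun h u hu => h u (Submodule.subset_span hu), fun h u hu => ?_⟩
  induction hu using Submodule.span_induction with
  | mem u hu => exact h u hu
  | zero => simp
  | add x y _ _ hx hy => rw [inner_add_left, hx, hy, add_zero]
  | smul a x _ hx => rw [inner_smul_left, hx, mul_zero]

/-- A compact operator between Hilbert spaces attains its norm. -/
theorem exists_norm_apply_eq {E F : Type*} [NormedAddCommGroup E] [InnerProductSpace ℂ E]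
    [CompleteSpace E] [Nontrivial E] [NormedAddCommGroup F] [InnerProductSpace ℂ F]
    [CompleteSpace F] {T : E →L[ℂ] F} (hT : IsCompactOperator T) :
    ∃ v, ‖v‖ = 1 ∧ ‖T v‖ = ‖T‖ := by
  rcases eq_or_ne T 0 with rfl | hT0
  · obtain ⟨v, hv⟩ := exists_norm_eq E zero_le_one
    exact ⟨v, hv, by simp⟩
  have hpos : 0 < ‖T‖ := norm_pos_iff.mpr hT0
  set B : Set F := closure (T '' Metric.closedBall 0 1) with hB
  have hcomp : IsCompact B := hT.isCompact_closure_image_closedBall 1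
  obtain ⟨y, hy, hmax⟩ := hcomp.exists_isMaxOn
    (⟨T 0, subset_closure ⟨0, by simp, rfl⟩⟩ : B.Nonempty) continuous_norm.continuousOn
  have hTy : ‖T‖ ≤ ‖y‖ := by
    refine T.opNorm_le_of_unit_norm (norm_nonneg _) fun x hx => hmax (subset_closure ⟨x, ?_, rfl⟩)
    simp [hx]
  have hclosed (a : ℝ) {p : F → ℝ} (hp : Continuous p)
      (h : ∀ x, ‖x‖ ≤ 1 → p (T x) ≤ a) : p y ≤ a := by
    have : B ⊆ {z | p z ≤ a} := by
      refine closure_minimal ?_ (isClosed_le hp continuous_const)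
      rintro _ ⟨x, hx, rfl⟩
      exact h x (by simpa using hx)
    exact this hy
  have hyT : ‖y‖ ≤ ‖T‖ := hclosed _ continuous_norm fun x hx =>
    (T.le_opNorm x).trans (mul_le_of_le_one_right (norm_nonneg _) hx)
  have hyn : ‖y‖ = ‖T‖ := le_antisymm hyT hTy
  -- The maximizer `y` is only known to lie in the closure of the image, so a vector of `E` is
  -- recovered through the adjoint: bounding `⟪y, T x⟫` gives `‖T‖² ≤ ‖w‖`, and bounding `⟪y, T w⟫`
  -- gives `‖w‖² ≤ ‖T w‖ ‖T‖`.
  set w := T.adjoint y with hw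
  have hw1 : ‖T‖ ^ 2 ≤ ‖w‖ := by
    have := hclosed ‖w‖ (p := fun z => RCLike.re ⟪y, z⟫_ℂ) (by fun_prop) fun x hx => by
      rw [← ContinuousLinearMap.adjoint_inner_left]
      exact (re_inner_le_norm _ _).trans (mul_le_of_le_one_right (norm_nonneg _) hx)
    rwa [inner_self_eq_norm_sq, hyn] at this
  have hw0 : 0 < ‖w‖ := lt_of_lt_of_le (by positivity) hw1
  have hw2 : ‖T‖ * ‖w‖ ≤ ‖T w‖ := by
    have h1 : ‖w‖ ^ 2 ≤ ‖T w‖ * ‖T‖ := by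
      rw [← hyn, ← inner_self_eq_norm_sq (𝕜 := ℂ), hw, ContinuousLinearMap.adjoint_inner_right]
      exact re_inner_le_norm _ _
    have h2 : ‖T‖ ^ 2 * ‖w‖ ≤ ‖w‖ ^ 2 := by rw [sq ‖w‖]; gcongr
    have h3 : ‖T‖ * (‖T‖ * ‖w‖) ≤ ‖T‖ * ‖T w‖ := by nlinarith
    exact le_of_mul_le_mul_left h3 hpos
  refine ⟨((‖w‖⁻¹ : ℝ) : ℂ) • w, ?_, le_antisymm ?_ ?_⟩
  · rw [norm_smul, Complex.norm_real, norm_inv, norm_norm, inv_mul_cancel₀ hw0.ne']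
  · refine (T.le_opNorm _).trans_eq ?_
    rw [norm_smul, Complex.norm_real, norm_inv, norm_norm, inv_mul_cancel₀ hw0.ne', mul_one]
  · rw [map_smul, norm_smul, Complex.norm_real, norm_inv, norm_norm, le_inv_mul_iff₀ hw0, mul_comm]
    exact hw2

omit [CompleteSpace H] in
/-- The image of a maximizing vector is orthogonal to the images of the orthogonal vectors. -/
theorem inner_apply_eq_zero_of_max {X : H →L[ℂ] H} {u v : H} (hu : ‖u‖ = 1) (huv : ⟪u, v⟫_ℂ = 0)
    (h : ∀ a : ℂ, ‖X (u + a • v)‖ ≤ ‖X u‖ * ‖u + a • v‖) : ⟪X u, X v⟫_ℂ = 0 := by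
  set z := ⟪X u, X v⟫_ℂ with hz
  by_contra hz0
  -- Perturbing by `a = r z̄` turns the cross term into `r ‖z‖²`; a first-order gain bounded by a
  -- second-order term is impossible for small `r > 0`.
  have key (r : ℝ) : 2 * r * ‖z‖ ^ 2 ≤ r ^ 2 * ‖z‖ ^ 2 * (‖X u‖ ^ 2 * ‖v‖ ^ 2) := by
    have h1 := h (r * starRingEnd ℂ z)
    have h2 := pow_le_pow_left₀ (norm_nonneg _) h1 2
    rw [mul_pow, map_add, norm_add_sq (𝕜 := ℂ), norm_add_sq (𝕜 := ℂ) u, inner_smul_right,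
      huv, map_smul, inner_smul_right, ← hz, hu, norm_smul, norm_smul, norm_mul,
      Complex.norm_real, mul_assoc, RCLike.conj_mul] at h2
    have h3 : RCLike.re ((r : ℂ) * ((‖z‖ : ℝ) : ℂ) ^ 2) = r * ‖z‖ ^ 2 := by
      rw [← Complex.ofReal_pow, ← Complex.ofReal_mul]
      exact Complex.ofReal_re _
    have h4 : ‖(starRingEnd ℂ) z‖ = ‖z‖ := RCLike.norm_conj z
    have h5 : RCLike.re ((r : ℂ) * ((RCLike.ofReal ‖z‖ : ℂ)) ^ 2) = r * ‖z‖ ^ 2 := h3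
    rw [h4, h5, mul_pow, mul_pow, mul_pow, mul_pow, Real.norm_eq_abs, sq_abs] at h2
    simp only [mul_zero, map_zero] at h2
    nlinarith [mul_nonneg (mul_nonneg (sq_nonneg r) (sq_nonneg ‖z‖)) (sq_nonneg ‖X v‖)]
  have hzp : 0 < ‖z‖ ^ 2 := by positivity
  have hK : 0 ≤ ‖X u‖ ^ 2 * ‖v‖ ^ 2 := by positivity
  have hk := key (1 / (‖X u‖ ^ 2 * ‖v‖ ^ 2 + 1))
  set K := ‖X u‖ ^ 2 * ‖v‖ ^ 2
  have hr : 0 < 1 / (K + 1) := by positivity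
  have hrK : 1 / (K + 1) * K ≤ 1 := by
    rw [one_div_mul_eq_div]
    exact (div_le_one (by positivity)).mpr (by linarith)
  nlinarith [mul_pos hr hzp]

/-- Dependent choice in which the condition on a term involves the whole set of earlier terms, as
maximality on their orthogonal complement does. -/
theorem exists_seq_image_range {α : Type*} [DecidableEq α] {P : Finset α → α → Prop}
    (h : ∀ s, ∃ a, P s a) : ∃ u : ℕ → α, ∀ n, P ((Finset.range n).image u) (u n) := by
  choose F hF using h
  let u : ℕ → α := fun n => Nat.strongRec (motive := fun _ => α)
    (fun n ih => F ((Finset.univ : Finset (Fin n)).image fun i : Fin n => ih i i.2)) n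
  have hu (n) : u n = F ((Finset.range n).image u) := by
    have h1 : u n = F ((Finset.univ : Finset (Fin n)).image fun i : Fin n => u i) := by
      simp only [u]
      rw [Nat.strongRec_eq]
    rw [h1]
    congr 1
    ext a
    simp only [Finset.mem_image, Finset.mem_univ, true_and, Finset.mem_range]
    exact ⟨fun ⟨i, hi⟩ => ⟨i, i.2, hi⟩, fun ⟨i, hi, h⟩ => ⟨⟨i, hi⟩, h⟩⟩
  exact ⟨u, fun n => hu n ▸ hF _⟩

theorem isCompactOperator_of_tendsto_sNumbers {X : H →L[ℂ] H}
    (hX : Tendsto (sNumbers X) atTop (𝓝 0)) : IsCompactOperator X := by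
  have hex (n : ℕ) := exists_norm_sub_lt (X := X) (n := n)
    (a := sNumbers X n + 1 / ((n : ℝ) + 1)) (by simp; positivity)
  choose F hF hlt using hex
  refine isCompactOperator_of_tendsto (F := F) (l := atTop) ?_ (Eventually.of_forall fun n => ?_)
  · rw [tendsto_iff_norm_sub_tendsto_zero]
    refine squeeze_zero (fun _ => norm_nonneg _) (fun n => ?_)
      (by simpa only [add_zero] using hX.add tendsto_one_div_add_atTop_nhds_zero_nat)
    rw [norm_sub_rev]
    exact (hlt n).le
  · have hfin : FiniteDimensional ℂ (LinearMap.range (F n : H →ₗ[ℂ] H)) :=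
      Module.rank_lt_aleph0_iff.mp ((hF n).trans_lt (Cardinal.natCast_lt_aleph0))
    have hproper : ProperSpace (LinearMap.range (F n : H →ₗ[ℂ] H)) := FiniteDimensional.proper ℂ _
    let G : H →L[ℂ] LinearMap.range (F n : H →ₗ[ℂ] H) := (F n).codRestrict (LinearMap.range (F n : H →ₗ[ℂ] H)) fun v => ⟨v, rfl⟩
    have hG : IsCompactOperator (G : H → LinearMap.range (F n : H →ₗ[ℂ] H)) :=
      isCompactOperator_of_locallyCompactSpace_dom G
    exact hG.clm_comp (LinearMap.range (F n : H →ₗ[ℂ] H)).subtypeL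

/-- The singular value decomposition of a compact operator. -/
theorem exists_eq_diagOp (hH : ¬ FiniteDimensional ℂ H) {X : H →L[ℂ] H}
    (hX : sNumbers X ∈ cZeroStar) : ∃ (e f : ℕ → H) (he : Orthonormal ℂ e) (hf : Orthonormal ℂ f),
      X = diagOp (isBdd_of_mem hX) he hf := by
  classical
  have hcomp := isCompactOperator_of_tendsto_sNumbers hX.2
  -- A pair holds `e n`, a unit vector maximizing `‖X v‖` orthogonally to the earlier ones, and `f
  -- n`, the direction of `X (e n)`. If `X (e n) = 0` there is no such direction, and `f n` is
  -- chosen orthogonal to the earlier `f`'s.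
  obtain ⟨u, hu⟩ := exists_seq_image_range (α := H × H) (P := fun s p =>
    ‖p.1‖ = 1 ∧ (∀ q ∈ s, ⟪q.1, p.1⟫_ℂ = 0) ∧
    (∀ v, (∀ q ∈ s, ⟪q.1, v⟫_ℂ = 0) → ‖X v‖ ≤ ‖X p.1‖ * ‖v‖) ∧
    ‖p.2‖ = 1 ∧ X p.1 = (‖X p.1‖ : ℂ) • p.2 ∧ (X p.1 = 0 → ∀ q ∈ s, ⟪q.2, p.2⟫_ℂ = 0)) (by
      intro s
      have h1 := nontrivial_orthogonal_span hH (s.image Prod.fst)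
      obtain ⟨a, ha1, ha⟩ := exists_norm_apply_eq (T := X ∘L (Submodule.span ℂ
          ((s.image Prod.fst : Finset H) : Set H))ᗮ.subtypeL) (hcomp.comp_clm
            (Submodule.span ℂ ((s.image Prod.fst : Finset H) : Set H))ᗮ.subtypeL)
      have hmem {v : H} : v ∈ (Submodule.span ℂ ((s.image Prod.fst : Finset H) : Set H))ᗮ ↔
          ∀ q ∈ s, ⟪q.1, v⟫_ℂ = 0 := by
        rw [mem_orthogonal_span_iff]
        simp
      have hmax (v : H) (hv : ∀ q ∈ s, ⟪q.1, v⟫_ℂ = 0) : ‖X v‖ ≤ ‖X a‖ * ‖v‖ := by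
        have := (X ∘L (Submodule.span ℂ
          ((s.image Prod.fst : Finset H) : Set H))ᗮ.subtypeL).le_opNorm ⟨v, hmem.mpr hv⟩
        erw [← ha] at this
        exact this
      by_cases hXa : X a = 0
      · have h2 := nontrivial_orthogonal_span hH (s.image Prod.snd)
        obtain ⟨b, hb⟩ := exists_norm_eq
          (Submodule.span ℂ ((s.image Prod.snd : Finset H) : Set H))ᗮ zero_le_one
        have hb' := mem_orthogonal_span_iff.mp b.2
        exact ⟨(a, b), ha1, hmem.mp a.2, hmax, hb, by simp [hXa], fun _ q hq =>
          hb' q.2 (by simpa using ⟨q.1, hq⟩)⟩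
      · have hn : (‖X a‖ : ℂ) ≠ 0 := by simpa using hXa
        refine ⟨(a, (‖X a‖ : ℂ)⁻¹ • X a), ha1, hmem.mp a.2, hmax, ?_, ?_, fun h => absurd h hXa⟩
        · rw [norm_smul, norm_inv, Complex.norm_real, norm_norm,
            inv_mul_cancel₀ (norm_ne_zero_iff.mpr hXa)]
        · rw [smul_smul, mul_inv_cancel₀ hn, one_smul])
  simp only [Finset.mem_image, Finset.mem_range, forall_exists_index, and_imp,
    forall_apply_eq_imp_iff₂] at hu
  choose hu1 hu2 hu3 hu4 hu5 hu6 using hu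
  set e : ℕ → H := fun n => (u n).1
  set f : ℕ → H := fun n => (u n).2
  let t : ℕ → ℝ := fun n => ‖X (e n)‖
  have h0 (n) : 0 ≤ t n := norm_nonneg _
  have ht : Antitone t := antitone_nat_of_succ_le fun n => by
    have := hu3 n (e (n + 1)) fun i hi => hu2 (n + 1) i (hi.trans n.lt_succ_self)
    rwa [hu1, mul_one] at this
  have hee : ∀ m n, m < n → ⟪e m, e n⟫_ℂ = 0 := fun m n hmn => hu2 n m hmn
  have he : Orthonormal ℂ e := by
    refine ⟨hu1, fun m n hmn => ?_⟩
    rcases lt_or_gt_of_ne hmn with h | h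
    · exact hee m n h
    · exact inner_eq_zero_symm.mp (hee n m h)
  have hXX : ∀ m n, m < n → ⟪X (e m), X (e n)⟫_ℂ = 0 := fun m n hmn =>
    inner_apply_eq_zero_of_max (hu1 m) (hee m n hmn) fun a => hu3 m _ fun i hi => by
      rw [inner_add_right, inner_smul_right]
      have h1 := hee i m hi
      have h2 := hee i n (hi.trans hmn)
      simp only [e] at h1 h2 ⊢
      rw [h1, h2, mul_zero, add_zero]
  have hff : ∀ m n, m < n → ⟪f m, f n⟫_ℂ = 0 := fun m n hmn => by
    by_cases hn : X (e n) = 0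
    · exact hu6 n hn m hmn
    · have htn : 0 < t n := norm_pos_iff.mpr hn
      have htm : 0 < t m := htn.trans_le (ht hmn.le)
      have h := hXX m n hmn
      have h1 : X (e m) = (t m : ℂ) • f m := hu5 m
      have h2 : X (e n) = (t n : ℂ) • f n := hu5 n
      rw [h1, h2, inner_smul_left, inner_smul_right] at h
      have h3 : (t m : ℂ) ≠ 0 := by exact_mod_cast htm.ne'
      have h4 : (t n : ℂ) ≠ 0 := by exact_mod_cast htn.ne'
      simpa [h3, h4] using h
  have hf : Orthonormal ℂ f := by
    refine ⟨hu4, fun m n hmn => ?_⟩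
    rcases lt_or_gt_of_ne hmn with h | h
    · exact hff m n h
    · exact inner_eq_zero_symm.mp (hff n m h)
  have ht0 : t ∈ cZeroStar :=
    mem_cZeroStar_of_le ht h0 hX.2 (le_sNumbers_of_apply he hf ht h0 hu5)
  have hXd : X = diagOp (isBdd_of_mem ht0) he hf := by
    have hcomm := comp_isom_eq he hf (isBdd_of_mem ht0) hu5
    ext v
    set p := isom he ((isom he).adjoint v) with hp
    have hXp : X p = diagOp (isBdd_of_mem ht0) he hf v :=
      DFunLike.congr_fun hcomm ((isom he).adjoint v)
    have horth (n) : ⟪e n, v - p⟫_ℂ = 0 := by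
      rw [← adjoint_isom_apply he, map_sub, hp]
      have : (isom he).adjoint (isom he ((isom he).adjoint v)) = (isom he).adjoint v :=
        DFunLike.congr_fun (adjoint_isom_comp_isom he) _
      rw [this, sub_self]
      rfl
    -- The part of `v` orthogonal to all `e n` competes at every stage, so `X` kills it because `t`
    -- tends to `0`.
    have hle (n) : ‖X (v - p)‖ ≤ t n * ‖v - p‖ := hu3 n _ fun i _ => horth i
    have hlim : ‖X (v - p)‖ ≤ 0 :=
      ge_of_tendsto' (by simpa using ht0.2.mul_const ‖v - p‖) hle
    rw [← hXp, ← sub_eq_zero, ← map_sub]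
    exact norm_le_zero_iff.mp hlim
  have hst : sNumbers X = t := by
    rw [hXd]
    exact sNumbers_diagOp ht0 he hf
  exact ⟨e, f, he, hf, hXd.trans (diagOp_congr _ _ he hf hst.symm)⟩

/-- If the `s`-numbers of `X` do not tend to `0`, then `X` factors the identity. -/
theorem exists_mul_mul_eq_one [TopologicalSpace.SeparableSpace H]
    (hH : ¬ FiniteDimensional ℂ H) {X : H →L[ℂ] H}
    (hX : ¬ Tendsto (sNumbers X) atTop (𝓝 0)) : ∃ A B : H →L[ℂ] H, A * X * B = 1 := by
  classical
  obtain ⟨b⟩ := exists_hilbertBasis_nat hH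
  have hbdd : BddBelow (Set.range (sNumbers X)) :=
    ⟨0, by rintro _ ⟨n, rfl⟩; exact sNumbers_nonneg X n⟩
  set δ := ⨅ n, sNumbers X n with hδ
  have hlim : Tendsto (sNumbers X) atTop (𝓝 δ) := tendsto_atTop_ciInf (antitone_sNumbers X) hbdd
  have hδ0 : 0 < δ := (le_ciInf (sNumbers_nonneg X)).lt_of_ne fun h => hX (h ▸ hlim)
  have hstep (s : Finset H) : ∃ y : H, (‖y‖ = 1 ∧ δ / 2 ≤ ‖X y‖) ∧
      ∀ x ∈ s, ⟪x, y⟫_ℂ = 0 ∧ ⟪X x, X y⟫_ℂ = 0 := by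
    by_contra! hcon
    -- Orthogonality to `X* X x` is orthogonality of the images. If no vector worked, `X` would be
    -- bounded by `δ / 2` on `Kᗮ`, hence within `δ / 2` of the finite-rank operator `X *
    -- K.starProjection`, contradicting the choice of `δ`.
    set s' : Finset H := s ∪ s.image (fun x => X.adjoint (X x)) with hs'
    set K := Submodule.span ℂ (s' : Set H) with hK
    have hfin : FiniteDimensional ℂ K := FiniteDimensional.span_finset ℂ s'
    have hsmall (w : H) (hw : w ∈ Kᗮ) : ‖X w‖ ≤ δ / 2 * ‖w‖ := by
      by_contra! hlt
      have hw0 : 0 < ‖w‖ := norm_pos_iff.mpr fun h => by simp [h] at hlt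
      have hw' := mem_orthogonal_span_iff.mp hw
      obtain ⟨x, hx, hx'⟩ := hcon (((‖w‖⁻¹ : ℝ) : ℂ) • w) ⟨by
        rw [norm_smul, Complex.norm_real, norm_inv, norm_norm, inv_mul_cancel₀ hw0.ne'], by
        rw [map_smul, norm_smul, Complex.norm_real, norm_inv, norm_norm, le_inv_mul_iff₀ hw0,
          mul_comm]
        exact hlt.le⟩
      have h1 := hw' x (by simp [hs', hx])
      have h2 := hw' (X.adjoint (X x)) (by
        simp only [hs', Finset.coe_union, Finset.coe_image]
        exact Or.inr ⟨x, hx, rfl⟩)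
      rw [ContinuousLinearMap.adjoint_inner_left] at h2
      refine hx' ?_ ?_
      · rw [inner_smul_right, h1, mul_zero]
      · rw [map_smul, inner_smul_right, h2, mul_zero]
    have hrank : LinearMap.rank ((X * K.starProjection : H →L[ℂ] H) : H →ₗ[ℂ] H) ≤
        ((s'.card : ℕ) : Cardinal) := by
      refine (LinearMap.rank_comp_le_right (K.starProjection : H →ₗ[ℂ] H) (X : H →ₗ[ℂ] H)).trans ?_
      refine (Submodule.rank_mono (t := K) ?_).trans (rank_span_finset_le _)
      rintro _ ⟨v, rfl⟩
      exact K.starProjection_apply_mem v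
    have h1 := sNumbers_le (X := X) hrank
    have h2 : ‖X - X * K.starProjection‖ ≤ δ / 2 := by
      refine ContinuousLinearMap.opNorm_le_bound _ (by positivity) fun v => ?_
      have h3 : (X - X * K.starProjection) v = X (v - K.starProjection v) := by simp
      rw [h3]
      refine (hsmall _ (K.sub_starProjection_mem_orthogonal v)).trans ?_
      gcongr
      rw [← Submodule.starProjection_orthogonal_val]
      exact Kᗮ.norm_starProjection_apply_le v
    have h3 := ciInf_le hbdd s'.card
    linarith
  obtain ⟨e, he1, he2⟩ := exists_seq_of_forall_finset_exists
    (fun y : H => ‖y‖ = 1 ∧ δ / 2 ≤ ‖X y‖) (fun x y => ⟪x, y⟫_ℂ = 0 ∧ ⟪X x, X y⟫_ℂ = 0)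
    fun s _ => hstep s
  have he : Orthonormal ℂ e := by
    refine ⟨fun n => (he1 n).1, fun m n hmn => ?_⟩
    rcases lt_or_gt_of_ne hmn with h | h
    · exact (he2 m n h).1
    · exact inner_eq_zero_symm.mp (he2 n m h).1
  let t : ℕ → ℝ := fun n => ‖X (e n)‖
  have htpos (n) : 0 < t n := (half_pos hδ0).trans_le (he1 n).2
  have htc (n) : (t n : ℂ) ≠ 0 := by exact_mod_cast (htpos n).ne'
  let f : ℕ → H := fun n => (t n : ℂ)⁻¹ • X (e n)
  have hf : Orthonormal ℂ f := by
    refine ⟨fun n => ?_, fun m n hmn => ?_⟩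
    · simp only [f]
      rw [norm_smul, norm_inv, Complex.norm_real, norm_norm, inv_mul_cancel₀ (htpos n).ne']
    · simp only [f]
      rw [inner_smul_left, inner_smul_right]
      rcases lt_or_gt_of_ne hmn with h | h
      · rw [(he2 m n h).2, mul_zero, mul_zero]
      · rw [inner_eq_zero_symm.mp (he2 n m h).2, mul_zero, mul_zero]
  have htb : IsBdd t := ⟨‖X‖, fun n => by
    rw [abs_of_pos (htpos n)]
    simpa [(he1 n).1] using X.le_opNorm (e n)⟩
  have htb' : IsBdd t⁻¹ := ⟨(δ / 2)⁻¹, fun n => by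
    rw [Pi.inv_apply, abs_of_pos (inv_pos.mpr (htpos n))]
    exact inv_anti₀ (half_pos hδ0) (he1 n).2⟩
  have hcomm := comp_isom_eq he hf htb (X := X) fun n => by
    simp only [f]
    rw [smul_smul, mul_inv_cancel₀ (htc n), one_smul]
  -- The right factor carries the basis to `e`, `X` carries `e` to `t f`, and the left factor
  -- returns to the basis dividing by `t`, which is bounded since `t ≥ δ / 2`.
  refine ⟨diagOp htb' hf b.orthonormal, diagOp isBdd_one b.orthonormal he, ?_⟩
  have h1 : X * diagOp isBdd_one b.orthonormal he = diagOp htb b.orthonormal hf := by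
    ext v
    have h := DFunLike.congr_fun hcomm ((isom b.orthonormal).adjoint v)
    rw [diagOp, mulOp_one]
    exact h
  have h2 : t⁻¹ * t = 1 := funext fun n => inv_mul_cancel₀ (htpos n).ne'
  rw [mul_assoc, h1, diagOp_mul, diagOp_congr _ isBdd_one _ _ h2, diagOp, mulOp_one]
  exact isom_comp_adjoint b

end Sequences

/-! ### The Calkin correspondence. -/

section Ideals

variable {H : Type*} [NormedAddCommGroup H] [InnerProductSpace ℂ H]

theorem mem_cZeroStar_of_sNumbers_le {X : H →L[ℂ] H} {ξ : ℕ → ℝ} (hξ : Tendsto ξ atTop (𝓝 0))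
    (h : ∀ n, sNumbers X n ≤ ξ n) : sNumbers X ∈ cZeroStar :=
  mem_cZeroStar_of_le (antitone_sNumbers X) (sNumbers_nonneg X) hξ h

theorem IsCharSet.sNumbers_mem_of_le {S : Set (ℕ → ℝ)} (hS : IsCharSet S) {X : H →L[ℂ] H}
    {ξ : ℕ → ℝ} (hξ : ξ ∈ S) {C : ℝ} (h : ∀ n, sNumbers X n ≤ C * ξ n) : sNumbers X ∈ S :=
  hS.mono_mul (mem_cZeroStar_of_sNumbers_le
    (by simpa using (hS.subset hξ).2.const_mul C) h) hξ C h

/-- The operators with `s`-numbers in a characteristic set form an ideal. -/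
theorem mem_idealOf_iff {S : Set (ℕ → ℝ)} (hS : IsCharSet S) {X : H →L[ℂ] H} :
    X ∈ idealOf S ↔ sNumbers X ∈ S := by
  have hleft (A X : H →L[ℂ] H) (hX : sNumbers X ∈ S) : sNumbers (A * X) ∈ S :=
    hS.sNumbers_mem_of_le hX (sNumbers_mul_left_le A X)
  let J : TwoSidedIdeal (H →L[ℂ] H) := TwoSidedIdeal.mk' {X | sNumbers X ∈ S}
    (by rw [Set.mem_ofPred_eq, sNumbers_zero]; exact hS.zero_mem)
    (fun {X Y} hX hY => hS.sNumbers_mem_of_le (C := 1) (hS.dilate_mem (hS.add_mem hX hY))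
      fun n => by simpa using sNumbers_add_le_dilate X Y n)
    (fun {X} hX => by simpa using hleft (-1) X hX)
    (fun {A X} hX => hleft A X hX)
    (fun {X A} hX => hS.sNumbers_mem_of_le hX (sNumbers_mul_right_le X A))
  constructor
  · intro hX
    have hle : idealOf S ≤ J := TwoSidedIdeal.span_le.mpr fun Y hY => by
      rw [SetLike.mem_coe, TwoSidedIdeal.mem_mk']
      exact hY
    have := hle hX
    rwa [TwoSidedIdeal.mem_mk'] at this
  · intro hX
    exact TwoSidedIdeal.subset_span hX

variable [CompleteSpace H]

omit [CompleteSpace H] in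
theorem sNumbers_one_notMem (b : HilbertBasis ℕ ℂ H) :
    sNumbers (1 : H →L[ℂ] H) ∉ cZeroStar := fun h => by
  have h1 (n) : (1 : ℝ) ≤ sNumbers (1 : H →L[ℂ] H) n :=
    le_sNumbers_of_apply (t := 1) b.orthonormal b.orthonormal antitone_const
      (fun _ => zero_le_one) (fun n => by simp) n
  have := ge_of_tendsto' h.2 h1
  norm_num at this

theorem charSet_idealOf (b : HilbertBasis ℕ ℂ H) {S : Set (ℕ → ℝ)} (hS : IsCharSet S) :
    charSet (idealOf S : TwoSidedIdeal (H →L[ℂ] H)) = S := by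
  ext ξ
  constructor
  · rintro ⟨_, X, hX, rfl⟩
    exact (mem_idealOf_iff hS).mp hX
  · intro hξ
    have h := sNumbers_diagOp (hS.subset hξ) b.orthonormal b.orthonormal
    exact ⟨hS.subset hξ, _, (mem_idealOf_iff hS).mpr (by rwa [h]), h⟩

omit [CompleteSpace H] in
theorem idealOf_ne_top (b : HilbertBasis ℕ ℂ H) {S : Set (ℕ → ℝ)} (hS : IsCharSet S) :
    (idealOf S : TwoSidedIdeal (H →L[ℂ] H)) ≠ ⊤ := fun h =>
  sNumbers_one_notMem b (hS.subset ((mem_idealOf_iff hS).mp (h ▸ TwoSidedIdeal.mem_top _)))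

/-- An ideal contains all the diagonal operators with coefficients in its characteristic set. -/
theorem diagOp_mem (hH : ¬ FiniteDimensional ℂ H) {I : TwoSidedIdeal (H →L[ℂ] H)} {ξ : ℕ → ℝ}
    (hξ : ξ ∈ charSet I) {e f : ℕ → H} (he : Orthonormal ℂ e) (hf : Orthonormal ℂ f) :
    diagOp (isBdd_of_mem hξ.1) he hf ∈ I := by
  obtain ⟨hξ0, X, hX, rfl⟩ := hξ
  obtain ⟨e', f', he', hf', hXd⟩ := exists_eq_diagOp hH hξ0
  -- The outer factors are partial isometries taking `e` to `e'` and `f'` to `f`, which moves the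
  -- decomposition of `X` to the prescribed sequences.
  have h : diagOp isBdd_one hf' hf * X * diagOp isBdd_one he he' ∈ I :=
    I.mul_mem_right _ _ (I.mul_mem_left _ _ hX)
  rw [hXd, diagOp_mul, diagOp_mul] at h
  rwa [diagOp_congr _ (isBdd_of_mem hξ0) _ _ (show 1 * sNumbers X * 1 = sNumbers X by simp)] at h

/-- Even and odd positions each carry one copy of `ξ`; this gives closure of `charSet I` under
dilation. -/
theorem diagOp_dilate {ξ : ℕ → ℝ} (hξ : ξ ∈ cZeroStar) {e : ℕ → H} (he : Orthonormal ℂ e) :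
    diagOp (isBdd_of_mem (dilate_mem_cZeroStar hξ)) he he =
      diagOp (isBdd_of_mem hξ)
        (he.comp (fun n => 2 * n) (mul_right_injective₀ two_ne_zero))
        (he.comp (fun n => 2 * n) (mul_right_injective₀ two_ne_zero)) +
      diagOp (isBdd_of_mem hξ)
        (he.comp (fun n => 2 * n + 1) fun m n h => by simpa using h)
        (he.comp (fun n => 2 * n + 1) fun m n h => by simpa using h) := by
  ext v
  refine (hasSum_diagOp _ he he v).unique (HasSum.even_add_odd ?_ ?_)
  · simpa [dilate] using! hasSum_diagOp (isBdd_of_mem hξ)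
      (he.comp (fun n => 2 * n) (mul_right_injective₀ two_ne_zero))
      (he.comp (fun n => 2 * n) (mul_right_injective₀ two_ne_zero)) v
  · have h (n : ℕ) : (2 * n + 1) / 2 = n := by omega
    simpa [dilate, h] using! hasSum_diagOp (isBdd_of_mem hξ)
      (he.comp (fun n => 2 * n + 1) fun m n h => by simpa using h)
      (he.comp (fun n => 2 * n + 1) fun m n h => by simpa using h) v

theorem isCharSet_charSet (hH : ¬ FiniteDimensional ℂ H) (b : HilbertBasis ℕ ℂ H)
    (I : TwoSidedIdeal (H →L[ℂ] H)) : IsCharSet (charSet I) where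
  subset _ h := h.1
  zero_mem := ⟨zero_mem_cZeroStar, 0, I.zero_mem, sNumbers_zero⟩
  mono {ξ η} hξ hη hle := by
    -- Where `η` vanishes so does `ξ`, and the convention `0 / 0 = 0` is harmless.
    have hq : IsBdd (ξ / η) := ⟨1, fun n => by
      have h1 := cZeroStar.nonneg hξ n
      have h2 := cZeroStar.nonneg hη.1 n
      rw [Pi.div_apply, abs_of_nonneg (div_nonneg h1 h2)]
      exact div_le_one_of_le₀ (hle n) h2⟩
    have h := I.mul_mem_left (diagOp hq b.orthonormal b.orthonormal) _
      (diagOp_mem hH hη b.orthonormal b.orthonormal)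
    rw [diagOp_mul, diagOp_congr _ (isBdd_of_mem hξ) _ _ (funext fun n => div_mul_cancel_of_imp
      fun h0 => le_antisymm ((hle n).trans_eq h0) (cZeroStar.nonneg hξ n))] at h
    exact ⟨hξ, _, h, sNumbers_diagOp hξ _ _⟩
  add_mem hξ hη := by
    have hsum := add_mem_cZeroStar hξ.1 hη.1
    have h := I.add_mem (diagOp_mem hH hξ b.orthonormal b.orthonormal)
      (diagOp_mem hH hη b.orthonormal b.orthonormal)
    rw [diagOp_add] at h
    exact ⟨hsum, _, h, sNumbers_diagOp hsum _ _⟩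
  dilate_mem hξ := by
    have hd := dilate_mem_cZeroStar hξ.1
    refine ⟨hd, _, ?_, sNumbers_diagOp hd b.orthonormal b.orthonormal⟩
    rw [diagOp_dilate hξ.1]
    exact I.add_mem (diagOp_mem hH hξ _ _) (diagOp_mem hH hξ _ _)

/-- A proper ideal consists of compact operators and is determined by its characteristic set. -/
theorem mem_iff_sNumbers_mem_charSet [TopologicalSpace.SeparableSpace H]
    (hH : ¬ FiniteDimensional ℂ H) {I : TwoSidedIdeal (H →L[ℂ] H)} (hI : I ≠ ⊤)
    {X : H →L[ℂ] H} : X ∈ I ↔ sNumbers X ∈ charSet I := by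
  constructor
  · intro hX
    refine ⟨⟨antitone_sNumbers X, ?_⟩, X, hX, rfl⟩
    by_contra hlim
    obtain ⟨A, B, hAB⟩ := exists_mul_mul_eq_one hH hlim
    refine hI ((I.one_mem_iff).mp ?_)
    rw [← hAB]
    exact I.mul_mem_right _ _ (I.mul_mem_left _ _ hX)
  · intro hX
    obtain ⟨e, f, he, hf, h⟩ := exists_eq_diagOp hH hX.1
    rw [h]
    exact diagOp_mem hH hX he hf

/-! ### The am-interior, am-open ideals and their intersections. -/

theorem charSet_preArithMeanIdeal (hH : ¬ FiniteDimensional ℂ H) (b : HilbertBasis ℕ ℂ H)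
    (I : TwoSidedIdeal (H →L[ℂ] H)) : charSet (preArithMeanIdeal I) = preMeanSet (charSet I) :=
  charSet_idealOf b (isCharSet_charSet hH b I).preMeanSet

theorem charSet_arithMeanIdeal (hH : ¬ FiniteDimensional ℂ H) (b : HilbertBasis ℕ ℂ H)
    (I : TwoSidedIdeal (H →L[ℂ] H)) : charSet (arithMeanIdeal I) = meanSet (charSet I) :=
  charSet_idealOf b (isCharSet_charSet hH b I).meanSet

theorem charSet_amInterior (hH : ¬ FiniteDimensional ℂ H) (b : HilbertBasis ℕ ℂ H)
    (I : TwoSidedIdeal (H →L[ℂ] H)) :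
    charSet (amInterior I) = {ξ | ξ ∈ cZeroStar ∧ omegaUnd ξ ∈ charSet I} := by
  rw [amInterior, charSet_arithMeanIdeal hH b, charSet_preArithMeanIdeal hH b,
    meanSet_preMeanSet (isCharSet_charSet hH b I)]

theorem amInterior_ne_top (hH : ¬ FiniteDimensional ℂ H) (b : HilbertBasis ℕ ℂ H)
    (I : TwoSidedIdeal (H →L[ℂ] H)) : amInterior I ≠ ⊤ :=
  idealOf_ne_top b (isCharSet_charSet hH b (preArithMeanIdeal I)).meanSet

variable [TopologicalSpace.SeparableSpace H]

theorem eq_of_charSet_eq (hH : ¬ FiniteDimensional ℂ H) {I J : TwoSidedIdeal (H →L[ℂ] H)}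
    (hI : I ≠ ⊤) (hJ : J ≠ ⊤) (h : charSet I = charSet J) : I = J :=
  TwoSidedIdeal.ext fun X => by
    rw [mem_iff_sNumbers_mem_charSet hH hI, mem_iff_sNumbers_mem_charSet hH hJ, h]

/-- Properness must be stated separately: `⊤` has the same characteristic set as the ideal of
compact operators. -/
theorem isAmOpen_iff (hH : ¬ FiniteDimensional ℂ H) (b : HilbertBasis ℕ ℂ H)
    {J : TwoSidedIdeal (H →L[ℂ] H)} : IsAmOpen J ↔
      J ≠ ⊤ ∧ ∀ ξ ∈ cZeroStar, omegaUnd ξ ∈ charSet J ↔ ξ ∈ charSet J := by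
  constructor
  · intro h
    refine ⟨h ▸ amInterior_ne_top hH b J, fun ξ hξ => ?_⟩
    conv_rhs => rw [← show amInterior J = J from h, charSet_amInterior hH b]
    exact ⟨fun h => ⟨hξ, h⟩, fun h => h.2⟩
  · rintro ⟨hJ, h⟩
    refine eq_of_charSet_eq hH (amInterior_ne_top hH b J) hJ ?_
    rw [charSet_amInterior hH b]
    ext ξ
    exact ⟨fun hξ => (h ξ hξ.1).mp hξ.2, fun hξ => ⟨hξ.1, (h ξ hξ.1).mpr hξ⟩⟩

/-- Membership in a proper ideal depends only on `s`-numbers, so one diagonal operator realizing `ξ`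
lies in all `J` at once. -/
theorem charSet_sInf (hH : ¬ FiniteDimensional ℂ H) (b : HilbertBasis ℕ ℂ H)
    {𝒥 : Set (TwoSidedIdeal (H →L[ℂ] H))} (h : ∀ J ∈ 𝒥, J ≠ ⊤) {ξ : ℕ → ℝ} (hξ : ξ ∈ cZeroStar) :
    ξ ∈ charSet (sInf 𝒥) ↔ ∀ J ∈ 𝒥, ξ ∈ charSet J := by
  constructor
  · rintro ⟨_, X, hX, rfl⟩ J hJ
    exact ⟨hξ, X, (TwoSidedIdeal.mem_sInf _).mp hX J hJ, rfl⟩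
  · intro hmem
    have hs := sNumbers_diagOp hξ b.orthonormal b.orthonormal
    refine ⟨hξ, _, (TwoSidedIdeal.mem_sInf _).mpr fun J hJ => ?_, hs⟩
    rw [mem_iff_sNumbers_mem_charSet hH (h J hJ), hs]
    exact hmem J hJ

theorem isAmOpen_sInf (hH : ¬ FiniteDimensional ℂ H) {𝒥 : Set (TwoSidedIdeal (H →L[ℂ] H))}
    (hne : 𝒥.Nonempty) (h : ∀ J ∈ 𝒥, IsAmOpen J) : IsAmOpen (sInf 𝒥) := by
  obtain ⟨b⟩ := exists_hilbertBasis_nat hH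
  have htop (J) (hJ : J ∈ 𝒥) := ((isAmOpen_iff hH b).mp (h J hJ)).1
  obtain ⟨J, hJ⟩ := hne
  refine (isAmOpen_iff hH b).mpr ⟨fun ht => htop J hJ (top_le_iff.mp (ht ▸ sInf_le hJ)),
    fun ξ hξ => ?_⟩
  rw [charSet_sInf hH b htop (omegaUnd_mem_cZeroStar hξ), charSet_sInf hH b htop hξ]
  exact forall₂_congr fun J hJ => ((isAmOpen_iff hH b).mp (h J hJ)).2 ξ hξ

/-- The ideal of compact operators is the largest am-open ideal. -/
theorem isAmOpen_idealOf_cZeroStar (hH : ¬ FiniteDimensional ℂ H) :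
    IsAmOpen (idealOf cZeroStar : TwoSidedIdeal (H →L[ℂ] H)) := by
  obtain ⟨b⟩ := exists_hilbertBasis_nat hH
  refine (isAmOpen_iff hH b).mpr ⟨idealOf_ne_top b isCharSet_cZeroStar, fun ξ hξ => ?_⟩
  rw [charSet_idealOf b isCharSet_cZeroStar]
  exact iff_of_true (omegaUnd_mem_cZeroStar hξ) hξ

theorem le_idealOf_cZeroStar (hH : ¬ FiniteDimensional ℂ H) {I : TwoSidedIdeal (H →L[ℂ] H)}
    (hI : I ≠ ⊤) : I ≤ idealOf cZeroStar := fun _ hX =>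
  (mem_idealOf_iff isCharSet_cZeroStar).mpr ((mem_iff_sNumbers_mem_charSet hH hI).mp hX).1

end Ideals

end

end AMIdeal

theorem theorem2p17 {H : Type*} [NormedAddCommGroup H] [InnerProductSpace ℂ H] [CompleteSpace H]
    [TopologicalSpace.SeparableSpace H] (hH : ¬ FiniteDimensional ℂ H) :
    (∀ 𝒥 : Set (TwoSidedIdeal (H →L[ℂ] H)), 𝒥.Nonempty →
      (∀ J ∈ 𝒥, AMIdeal.IsAmOpen J) → AMIdeal.IsAmOpen (sInf 𝒥)) ∧
    (∀ I : TwoSidedIdeal (H →L[ℂ] H), I ≠ ⊤ →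
      AMIdeal.charSet (AMIdeal.amInterior I) =
          {ξ | ξ ∈ AMIdeal.cZeroStar ∧ AMIdeal.omegaUnd ξ ∈ AMIdeal.charSet I} ∧
        IsLeast {J : TwoSidedIdeal (H →L[ℂ] H) | AMIdeal.IsAmOpen J ∧ I ≤ J}
          (AMIdeal.amOpenHull I)) := by
  refine ⟨fun 𝒥 hne h => AMIdeal.isAmOpen_sInf hH hne h, fun I hI => ⟨?_, ⟨?_, ?_⟩, ?_⟩⟩
  · obtain ⟨b⟩ := AMIdeal.exists_hilbertBasis_nat hH
    exact AMIdeal.charSet_amInterior hH b I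
  -- The ideal of compact operators witnesses that the family is nonempty; this is where `I ≠ ⊤`
  -- enters.
  · exact AMIdeal.isAmOpen_sInf hH ⟨_, AMIdeal.isAmOpen_idealOf_cZeroStar hH,
      AMIdeal.le_idealOf_cZeroStar hH hI⟩ fun J hJ => hJ.1
  · exact le_sInf fun J hJ => hJ.2
  · exact fun J hJ => sInf_le hJ
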